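/- Let $A$ be a finitely generated subring of $\mathbb{C}$ with field of fractions $K$, let $n\ge 1$, and let $\Gamma\subset SL(n,A)$ be a finitely generated subgroup. For a discrete valuation $\nu$ of $K$ (normalised to have value group $\mathbb{Z}$) with ring of integers $\mathcal{O}_\nu$ and uniformizer $\pi$, let $X_\nu$ be the affine (Bruhat--Tits) building of $SL(n,K)$: its vertices are the homothety classes of $\mathcal{O}_\nu$-lattices in $K^n$, and distinct vertices $\bar L_0,\dots,\bar L_k$ span a simplex if, after reordering, they have representatives with $L_0\subset L_1\subset\dots\subset L_k\subset\pi^{-1}L_0$. Its geometric realization carries the length metric for which each simplex is Euclidean, where the apartment of a basis $b_1,\dots,b_n$ of $K^n$ is identified with $\mathbb{R}^n/\mathbb{R}(1,\dots,1)$ by sending the class of $\bigoplus_i\pi^{-a_i}\mathcal{O}_\nu b_i$ to $(a_1,\dots,a_n)$. The group $SL(n,K)$, and hence $\Gamma$, acts on $X_\nu$ through its action on lattices. Then there are finitely many discrete valuations $\nu_1,\dots,\nu_m$ of $K$ ($m\ge 0$; an empty product is a point) such that: 1. each $X_{\nu_i}$ is an $(n-1)$-dimensional complex, the length distance on its realization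 is a metric (finite and separating points), this metric space has finite asymptotic dimension, and $\Gamma$ acts on it by isometries; 2. for the diagonal action $\gamma\cdot(x_1,\dots,x_m)=(\gamma x_1,\dots,\gamma x_m)$ of $\Gamma$ on $X_{\nu_1}\times\dots\times X_{\nu_m}$, the isotropy group in $\Gamma$ of every point has integral characteristic, i.e. the coefficients of the characteristic polynomial of each of its elements are algebraic integers. Here a metric space $X$ has finite asymptotic dimension if there is an integer $k\ge 0$ such that for every $d>0$ there is a cover of $X$ by sets of uniformly bounded diameter for which every ball of radius $d$ meets at most $k+1$ elements of the cover. -/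

import Mathlib

open scoped Pointwise ENNReal NNReal WithZero

noncomputable section

/-- A (normalised) discrete valuation of a field `K`, written multiplicatively: the additive
valuation is `ν` with `val x = exp (-ν x)` and `val 0 = 0`.  Surjectivity says that a uniformizer,
an element with `ν = 1`, exists. -/
structure DiscreteValuation (K : Type*) [Field K] where
  /-- the underlying valuation -/
  val : Valuation K ℤᵐ⁰
  /-- the value group is all of `ℤ` -/
  surjective : Function.Surjective val

namespace DiscreteValuation

variable {K : Type*} [Field K] (ν : DiscreteValuation K)

/-- The ring of integers of the valuation. -/
abbrev integers : ValuationSubring K := ν.val.valuationSubring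

/-- Some uniformizer, that is, an element of (additive) valuation `1`. -/
def uniformizer : K := (ν.surjective (WithZero.exp (-1))).choose

theorem val_uniformizer : ν.val ν.uniformizer = WithZero.exp (-1) :=
  (ν.surjective (WithZero.exp (-1))).choose_spec

theorem uniformizer_mem : ν.uniformizer ∈ ν.integers := by
  rw [Valuation.mem_valuationSubring_iff, ν.val_uniformizer, ← WithZero.exp_zero,
    WithZero.exp_le_exp]
  norm_num

/-! ### Lattices and their homothety classes -/

/-- Lattices in `K ^ n` over the ring of integers: finitely generated submodules that span
`K ^ n` over `K`. -/
def Lattice (n : ℕ) : Type _ :=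
  {M : Submodule ν.integers (Fin n → K) // M.IsLattice K}

variable {ν} {n : ℕ}

namespace Lattice

theorem isLattice_map (g : Matrix.SpecialLinearGroup (Fin n) K)
    (M : Submodule ν.integers (Fin n → K)) (hM : M.IsLattice K) :
    (M.map ((Matrix.toLin' (g : Matrix (Fin n) (Fin n) K)).restrictScalars
      ν.integers)).IsLattice K where
  fg := hM.fg.map _
  span_eq_top := by
    have h : Function.Surjective (Matrix.toLin' (g : Matrix (Fin n) (Fin n) K)) := by
      intro x
      refine ⟨Matrix.toLin' ((g⁻¹ : Matrix.SpecialLinearGroup (Fin n) K) :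
        Matrix (Fin n) (Fin n) K) x, ?_⟩
      rw [← Matrix.toLin'_mul_apply, ← Matrix.SpecialLinearGroup.coe_mul, mul_inv_cancel]
      simp
    have h2 : ((M.map ((Matrix.toLin' (g : Matrix (Fin n) (Fin n) K)).restrictScalars
        ν.integers) : Submodule ν.integers (Fin n → K)) : Set (Fin n → K)) =
        (Matrix.toLin' (g : Matrix (Fin n) (Fin n) K)) '' (M : Set (Fin n → K)) := rfl
    rw [h2, ← Submodule.map_span, hM.span_eq_top, Submodule.map_top,
      LinearMap.range_eq_top.mpr h]

/-- The natural action of `SL(n, K)` on lattices, `g • L = g L`. -/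
instance : MulAction (Matrix.SpecialLinearGroup (Fin n) K) (ν.Lattice n) where
  smul g L := ⟨L.1.map ((Matrix.toLin' (g : Matrix (Fin n) (Fin n) K)).restrictScalars
    ν.integers), isLattice_map g L.1 L.2⟩
  one_smul L := by
    apply Subtype.ext
    change L.1.map _ = L.1
    ext x
    simp
  mul_smul g h L := by
    apply Subtype.ext
    change L.1.map _ = (L.1.map _).map _
    rw [← Submodule.map_comp]
    congr 1
    ext x : 1
    simp [Matrix.toLin'_mul]

theorem smul_val (g : Matrix.SpecialLinearGroup (Fin n) K) (L : ν.Lattice n) :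
    (g • L).1 = L.1.map ((Matrix.toLin' (g : Matrix (Fin n) (Fin n) K)).restrictScalars
      ν.integers) := rfl

theorem map_smul_comm (g : Matrix.SpecialLinearGroup (Fin n) K) (c : K)
    (M : Submodule ν.integers (Fin n → K)) :
    (c • M).map ((Matrix.toLin' (g : Matrix (Fin n) (Fin n) K)).restrictScalars ν.integers) =
      c • M.map ((Matrix.toLin' (g : Matrix (Fin n) (Fin n) K)).restrictScalars
        ν.integers) := by
  ext x
  simp only [Submodule.mem_map, Submodule.mem_smul_pointwise_iff_exists]
  constructor
  · rintro ⟨_, ⟨y, hy, rfl⟩, rfl⟩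
    exact ⟨_, ⟨y, hy, rfl⟩, by simp⟩
  · rintro ⟨_, ⟨y, hy, rfl⟩, rfl⟩
    exact ⟨_, ⟨y, hy, rfl⟩, by simp⟩

/-- Two lattices are homothetic if they differ by a nonzero scalar of `K`. -/
instance homothety : Setoid (ν.Lattice n) where
  r L M := ∃ c : K, c ≠ 0 ∧ M.1 = c • L.1
  iseqv :=
    { refl := fun L => ⟨1, one_ne_zero, (one_smul K L.1).symm⟩
      symm := by
        rintro L M ⟨c, hc, h⟩
        exact ⟨c⁻¹, inv_ne_zero hc, by rw [h, smul_smul, inv_mul_cancel₀ hc, one_smul]⟩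
      trans := by
        rintro L M N ⟨c, hc, h⟩ ⟨d, hd, h'⟩
        exact ⟨d * c, mul_ne_zero hd hc, by rw [h', h, smul_smul]⟩ }

theorem smul_homothety (g : Matrix.SpecialLinearGroup (Fin n) K) (L M : ν.Lattice n)
    (h : L ≈ M) : g • L ≈ g • M := by
  obtain ⟨c, hc, h⟩ := h
  exact ⟨c, hc, by rw [smul_val, smul_val, h, map_smul_comm]⟩

end Lattice

variable (ν n)

/-- The vertices of the building: homothety classes of lattices in `K ^ n`. -/
def Vertex : Type _ := Quotient (Lattice.homothety (ν := ν) (n := n))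

variable {ν n}

/-- The homothety class of a lattice. -/
def Lattice.toVertex (L : ν.Lattice n) : ν.Vertex n := Quotient.mk _ L

/-- The action of `SL(n, K)` on homothety classes, `g • [L] = [g L]`. -/
instance : MulAction (Matrix.SpecialLinearGroup (Fin n) K) (ν.Vertex n) where
  smul g := Quotient.map (g • ·) (fun L M h => Lattice.smul_homothety g L M h)
  one_smul v := by
    induction v using Quotient.inductionOn with
    | h L => exact congrArg (Quotient.mk _) (one_smul _ L)
  mul_smul g h v := by
    induction v using Quotient.inductionOn with
    | h L => exact congrArg (Quotient.mk _) (mul_smul g h L)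

theorem smul_toVertex (g : Matrix.SpecialLinearGroup (Fin n) K) (L : ν.Lattice n) :
    g • L.toVertex = (g • L).toVertex := rfl

/-! ### The building -/

/-- A finite set of vertices is the vertex set of a simplex if its elements have representatives
which can be listed as `L₀ ⊂ L₁ ⊂ ⋯ ⊂ Lₘ ⊂ π⁻¹ L₀`: the representatives are totally ordered by
inclusion, and `π` times any of them lies in any other. -/
def IsSimplex (s : Finset (ν.Vertex n)) : Prop :=
  s.Nonempty ∧ ∃ rep : ν.Vertex n → ν.Lattice n,
    (∀ v ∈ s, (rep v).toVertex = v) ∧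
    (∀ v ∈ s, ∀ w ∈ s, (rep v).1 ≤ (rep w).1 ∨ (rep w).1 ≤ (rep v).1) ∧
    (∀ v ∈ s, ∀ w ∈ s, ν.uniformizer • (rep v).1 ≤ (rep w).1)

variable (ν n)

/-- The affine (Bruhat-Tits) building of `SL(n, K)` with respect to `ν`. -/
def building : AbstractSimplicialComplex (ν.Vertex n) where
  faces := {s | IsSimplex s}
  isRelLowerSet_faces := by
    rintro s ⟨hs, rep, h1, h2, h3⟩
    exact ⟨hs, fun t hts ht => ⟨ht, rep, fun v hv => h1 v (hts hv),
      fun v hv w hw => h2 v (hts hv) w (hts hw), fun v hv w hw => h3 v (hts hv) w (hts hw)⟩⟩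
  singleton_mem v := by
    refine ⟨Finset.singleton_nonempty v, fun w => Quotient.out w,
      fun w _ => Quotient.out_eq w, fun v' hv w hw => ?_, fun v' hv w hw => ?_⟩
    · rw [Finset.mem_singleton.mp hv, Finset.mem_singleton.mp hw]
      exact Or.inl le_rfl
    · rw [Finset.mem_singleton.mp hv, Finset.mem_singleton.mp hw]
      intro x hx
      obtain ⟨y, hy, rfl⟩ := (Submodule.mem_smul_pointwise_iff_exists _ _ _).mp hx
      exact Submodule.smul_mem _ (⟨ν.uniformizer, ν.uniformizer_mem⟩ : ν.integers) hy

variable {ν n}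

open Classical in
theorem isSimplex_image_smul (g : Matrix.SpecialLinearGroup (Fin n) K)
    (s : Finset (ν.Vertex n)) (hs : s ∈ (ν.building n).faces) :
    s.image (g • ·) ∈ (ν.building n).faces := by
  obtain ⟨hs, rep, h1, h2, h3⟩ := hs
  refine ⟨hs.image _, fun v => g • rep (g⁻¹ • v), ?_, ?_, ?_⟩
  · simp only [Finset.forall_mem_image, inv_smul_smul]
    intro v hv
    rw [← smul_toVertex, h1 v hv]
  · simp only [Finset.forall_mem_image, inv_smul_smul, Lattice.smul_val]
    intro v hv w hw
    exact (h2 v hv w hw).imp (fun h => Submodule.map_mono h) (fun h => Submodule.map_mono h)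
  · simp only [Finset.forall_mem_image, inv_smul_smul, Lattice.smul_val]
    intro v hv w hw
    rw [← Lattice.map_smul_comm]
    exact Submodule.map_mono (h3 v hv w hw)

/-! ### The geometric realization and its metric -/

variable (ν n)

/-- The geometric realization of the building: points are given by their barycentric coordinates,
which are non-negative, sum to `1`, and are supported on a simplex. -/
def Realization : Type _ :=
  {x : ν.Vertex n →₀ ℝ // (∀ v, 0 ≤ x v) ∧ x.sum (fun _ t => t) = 1 ∧
    x.support ∈ (ν.building n).faces}

variable {ν n}

/-- The vertex `v` lies in the apartment of the basis `b` of `K ^ n`, and its coordinate vector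
there is `a`: it is the class of the lattice spanned by the vectors `π ^ (-aᵢ) bᵢ`.  The vector
`a` is determined by `v` and `b` up to adding a multiple of `(1, …, 1)`. -/
def HasCoordinates (b : Module.Basis (Fin n) K (Fin n → K)) (v : ν.Vertex n) (a : Fin n → ℤ) :
    Prop :=
  ∃ L : ν.Lattice n, L.toVertex = v ∧
    L.1 = Submodule.span ν.integers (Set.range fun i => ν.uniformizer ^ (-a i) • b i)

/-- The Euclidean norm on `ℝ ^ n / ℝ (1, …, 1)`, that is, the Euclidean norm of the orthogonal
projection of `u` to the hyperplane of vectors with sum zero. -/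
def quotientNorm (u : Fin n → ℝ) : ℝ :=
  Real.sqrt (∑ i, (u i - (∑ j, u j) / n) ^ 2)

/-- `x` and `y` lie in a common closed simplex, and `r` is the Euclidean length of the segment
from `x` to `y` in this simplex.  The simplex lies in the apartment of some basis `b`, which is
identified with `ℝ ^ n / ℝ (1, …, 1)` through the coordinates of its vertices. -/
def IsSegment (x y : ν.Realization n) (r : ℝ) : Prop :=
  ∃ s ∈ (ν.building n).faces, x.1.support ⊆ s ∧ y.1.support ⊆ s ∧
    ∃ (b : Module.Basis (Fin n) K (Fin n → K)) (a : ν.Vertex n → Fin n → ℤ),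
      (∀ v ∈ s, HasCoordinates b v (a v)) ∧
      r = quotientNorm (fun i => ∑ v ∈ s, (x.1 v - y.1 v) * (a v i : ℝ))

/-- `HasPath x y t`: there is a broken line of length `t` from `x` to `y`, made of finitely many
segments each of which lies in a simplex. -/
inductive HasPath : ν.Realization n → ν.Realization n → ℝ≥0∞ → Prop
  | nil (x : ν.Realization n) : HasPath x x 0
  | cons {x y z : ν.Realization n} {r : ℝ} {t : ℝ≥0∞} (h : IsSegment x y r)
      (p : HasPath y z t) : HasPath x z (ENNReal.ofReal r + t)

theorem quotientNorm_neg (u : Fin n → ℝ) : quotientNorm (-u) = quotientNorm u := by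
  unfold quotientNorm
  congr 1
  refine Finset.sum_congr rfl fun i _ => ?_
  simp only [Pi.neg_apply, Finset.sum_neg_distrib]
  ring

theorem IsSegment.symm {x y : ν.Realization n} {r : ℝ} (h : IsSegment x y r) :
    IsSegment y x r := by
  obtain ⟨s, hs, hx, hy, b, a, ha, rfl⟩ := h
  refine ⟨s, hs, hy, hx, b, a, ha, ?_⟩
  rw [← quotientNorm_neg]
  congr 1
  funext i
  rw [Pi.neg_apply, ← Finset.sum_neg_distrib]
  exact Finset.sum_congr rfl fun v _ => by ring

theorem HasPath.trans {x y z : ν.Realization n} {t u : ℝ≥0∞} (p : HasPath x y t)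
    (q : HasPath y z u) : HasPath x z (t + u) := by
  induction p with
  | nil => rwa [zero_add]
  | cons h _ ih => rw [add_assoc]; exact .cons h (ih q)

theorem HasPath.symm {x y : ν.Realization n} {t : ℝ≥0∞} (p : HasPath x y t) :
    HasPath y x t := by
  induction p with
  | nil x => exact .nil x
  | cons h _ ih =>
    have := ih.trans (.cons h.symm (.nil _))
    rwa [add_zero, add_comm] at this

/-- The length metric on the geometric realization: the infimum of the lengths of the broken
lines joining two points. -/
instance : PseudoEMetricSpace (ν.Realization n) where
  edist x y := sInf {t | HasPath x y t}
  edist_self x := le_antisymm (sInf_le (HasPath.nil x)) bot_le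
  edist_comm x y := by
    congr 1
    ext t
    exact ⟨HasPath.symm, HasPath.symm⟩
  edist_triangle x y z := by
    rw [ENNReal.sInf_add]
    refine le_iInf₂ fun t ht => ?_
    rw [ENNReal.add_sInf]
    exact le_iInf₂ fun u hu => sInf_le (HasPath.trans ht hu)

open Classical in
/-- The action of `SL(n, K)` on the geometric realization, the affine extension of the action on
the vertices. -/
instance : MulAction (Matrix.SpecialLinearGroup (Fin n) K) (ν.Realization n) where
  smul g x := ⟨Finsupp.mapDomain (g • ·) x.1, by
    obtain ⟨x, h0, h1, h2⟩ := x
    refine ⟨fun v => ?_, ?_, ?_⟩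
    · have := Finsupp.mapDomain_apply (MulAction.injective g) x (g⁻¹ • v)
      simp only [smul_inv_smul] at this
      rw [this]
      exact h0 _
    · rw [Finsupp.sum_mapDomain_index_inj (MulAction.injective g)]
      exact h1
    · rw [Finsupp.mapDomain_support_of_injective (MulAction.injective g)]
      exact isSimplex_image_smul g _ h2⟩
  one_smul x := by
    apply Subtype.ext
    change Finsupp.mapDomain _ x.1 = x.1
    simp only [one_smul]
    exact Finsupp.mapDomain_id
  mul_smul g h x := by
    apply Subtype.ext
    change Finsupp.mapDomain _ x.1 = Finsupp.mapDomain _ (Finsupp.mapDomain _ x.1)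
    rw [← Finsupp.mapDomain_comp]
    congr 1
    funext v
    exact mul_smul g h v

end DiscreteValuation

/-! ### Dimension and asymptotic dimension -/

/-- A simplicial complex has dimension `d` if `d` is the largest dimension of a simplex, where a
simplex with `d + 1` vertices has dimension `d`. -/
def AbstractSimplicialComplex.HasDimension {V : Type*} (X : AbstractSimplicialComplex V)
    (d : ℕ) : Prop :=
  (∃ s ∈ X.faces, s.card = d + 1) ∧ ∀ s ∈ X.faces, s.card ≤ d + 1

/-- The distance of `X` is a metric: it is finite and separates points. -/
def IsGenuineMetric (X : Type*) [PseudoEMetricSpace X] : Prop :=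
  ∀ x y : X, edist x y ≠ ⊤ ∧ (edist x y = 0 → x = y)

/-- The asymptotic dimension of `X` is at most `k`: for every `d > 0` there is a uniformly bounded
cover of `X` such that every ball of radius `d` meets at most `k + 1` of its elements. -/
def AsdimLE (X : Type*) [PseudoEMetricSpace X] (k : ℕ) : Prop :=
  ∀ d : ℝ≥0, 0 < d → ∃ U : Set (Set X), ⋃₀ U = Set.univ ∧
    (∃ D : ℝ≥0, ∀ u ∈ U, ∀ x ∈ u, ∀ y ∈ u, edist x y ≤ D) ∧
    ∀ x : X, {u ∈ U | ∃ y ∈ u, edist y x ≤ d}.encard ≤ k + 1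

/-- `X` has finite asymptotic dimension. -/
def HasFiniteAsdim (X : Type*) [PseudoEMetricSpace X] : Prop :=
  ∃ k : ℕ, AsdimLE X k

/-! ### Integral characteristic and isotropy groups -/

/-- A subgroup of `SL(n, ℂ)` has integral characteristic if the coefficients of the characteristic
polynomial of each of its elements are algebraic integers. -/
def HasIntegralCharacteristic {n : ℕ} (Γ : Subgroup (Matrix.SpecialLinearGroup (Fin n) ℂ)) :
    Prop :=
  ∀ g ∈ Γ, ∀ k : ℕ, IsIntegral ℤ ((g : Matrix (Fin n) (Fin n) ℂ).charpoly.coeff k)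

section

variable {A : Subring ℂ} {K : Type*} [Field K] [Algebra A K] {n m : ℕ}

/-- The diagonal action of a subgroup `Γ` of `SL(n, A)` on a finite product of buildings of
`SL(n, K)`, through the map from `SL(n, A)` to `SL(n, K)`. -/
abbrev diagonalAction (Γ : Subgroup (Matrix.SpecialLinearGroup (Fin n) A))
    (ν : Fin m → DiscreteValuation K) : MulAction Γ (∀ i, (ν i).Realization n) :=
  MulAction.compHom (∀ i, (ν i).Realization n)
    ((Matrix.SpecialLinearGroup.map (algebraMap A K)).comp Γ.subtype)

/-- The isotropy group in `Γ` of a point `x` of the product of buildings, for the diagonal action,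
as a subgroup of `SL(n, ℂ)`. -/
def isotropyGroup (Γ : Subgroup (Matrix.SpecialLinearGroup (Fin n) A))
    (ν : Fin m → DiscreteValuation K) (x : ∀ i, (ν i).Realization n) :
    Subgroup (Matrix.SpecialLinearGroup (Fin n) ℂ) :=
  letI := diagonalAction Γ ν
  (MulAction.stabilizer Γ x).map ((Matrix.SpecialLinearGroup.map A.subtype).comp Γ.subtype)

end

end

/-! The arithmetic half finds finitely many valuations of $K$ that detect algebraic integers in $A$.
A transcendence basis chosen among the generators of $A$ gives a polynomial ring $P$ over
$\mathbb{Z}$ with fraction field $F$, $K/F$ finite, and a nonzero $f\in P$ such that for every $a\in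
A$ some $f^k a$ is integral over $P$. At a prime of $P$ not dividing $f$, such an $a$ is
automatically integral. If $a$ is also integral at the prime factors of $f$, its minimal polynomial
over $F$ has coefficients in the factorial ring $P$; if it is integral at the valuation $-\deg$,
these coefficients are constants, so $a$ is an algebraic integer. Each of these finitely many
valuations of $F$ is replaced by its finitely many extensions to $K$ (`exists_finite_isIntegral`,
`exists_finite_isIntegral_of_finiteType`).

The link with the buildings is `charpoly_coeff_mem_integers_of_smul_eq`. If $g$ fixes a point, it
permutes the vertices of the carrier simplex, so a power $g^m$ fixes a vertex, and even a lattice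
$L$ because $\det g=1$. Then $\sum_{i<m} g^iL$ is a $g$-stable lattice, and the characteristic
polynomial of $g$ has coefficients in $\mathcal{O}_\nu$. For an isotropy group this holds at every
chosen valuation, so these coefficients, which lie in $A$, are algebraic integers.

The geometric half rests on the level of a vector $e$ in a lattice $L$, the largest $k$ with
$e\in\pi^kL$. Differences of two levels are affine on each simplex and Lipschitz for the length
distance, and they separate points; inserting lattices between two given ones shows that the
distance is finite. For the asymptotic dimension, lattices are retracted to $\mathbb{Z}^n$ by
maximising levels over vectors with prescribed last nonzero coordinate (`flagLevel`). The cover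
consists of the classes of points joined by bounded steps whose retractions stay in one box. By the
ultrametric inequality errors do not add up along a chain of steps, so these classes are uniformly
bounded (`exists_close_of_chain`), while a ball sees at most $2^n$ boxes. -/

noncomputable section

namespace DiscreteValuation

variable {K : Type*} [Field K] (ν : DiscreteValuation K) {n : ℕ}

/-! ### The additive valuation -/

instance : ν.val.IsRankOneDiscrete := by
  have : Nontrivial (MonoidWithZeroHom.valueGroup (.ofClass ν.val)) := by
    refine ⟨⟨⟨Units.mk0 (ν.val ν.uniformizer) (by simp [ν.val_uniformizer]), ?_⟩, 1, ?_⟩⟩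
    · exact MonoidWithZeroHom.mem_valueGroup _ ⟨ν.uniformizer, rfl⟩
    · intro h
      have := congrArg (fun x => ((x.1 : (ℤᵐ⁰)ˣ) : ℤᵐ⁰)) h
      simp [ν.val_uniformizer] at this
  infer_instance

/-- Used twice: lattices are free because the ring is principal, and the integral closure in a
finite extension is a Dedekind domain. -/
instance : IsDiscreteValuationRing ν.integers :=
  ν.val.valuationSubring_isDiscreteValuationRing

/-- The additive valuation, with the value `0` at `0`. -/
def ord (x : K) : ℤ := -WithZero.log (ν.val x)

variable {ν}

theorem integers_smul_def (c : ν.integers) (x : Fin n → K) : c • x = (c : K) • x := rfl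

theorem val_eq_exp {x : K} (hx : x ≠ 0) : ν.val x = WithZero.exp (-ν.ord x) := by
  rw [ord, neg_neg, WithZero.exp_log (by simpa using hx)]

theorem ord_mul {x y : K} (hx : x ≠ 0) (hy : y ≠ 0) : ν.ord (x * y) = ν.ord x + ν.ord y := by
  rw [ord, map_mul, WithZero.log_mul (by simpa using hx) (by simpa using hy), ord, ord]
  ring

@[simp] theorem ord_one : ν.ord 1 = 0 := by simp [ord]

@[simp] theorem ord_inv (x : K) : ν.ord x⁻¹ = -ν.ord x := by
  rw [ord, map_inv₀, WithZero.log_inv, ord]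

theorem mem_integers_iff {x : K} (hx : x ≠ 0) : x ∈ ν.integers ↔ 0 ≤ ν.ord x := by
  rw [Valuation.mem_valuationSubring_iff, val_eq_exp hx, ← WithZero.exp_zero,
    WithZero.exp_le_exp]
  omega

theorem uniformizer_ne_zero : ν.uniformizer ≠ 0 := by
  intro h
  have := ν.val_uniformizer
  rw [h, map_zero] at this
  exact WithZero.exp_ne_zero this.symm

@[simp] theorem ord_uniformizer_zpow (k : ℤ) : ν.ord (ν.uniformizer ^ k) = k := by
  rw [ord, map_zpow₀, val_uniformizer, WithZero.log_zpow, WithZero.log_exp]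
  simp

theorem uniformizer_zpow_ne_zero (k : ℤ) : ν.uniformizer ^ k ≠ 0 :=
  zpow_ne_zero _ uniformizer_ne_zero

/-- The quotient `d * c⁻¹` is integral. Hence scalars matter only through their order and can be
traded for powers of the uniformizer. -/
theorem mem_of_smul_mem {M : Submodule ν.integers (Fin n → K)} {c d : K} (hc : c ≠ 0)
    (hd : d ≠ 0) {x : Fin n → K} (h : ν.ord c ≤ ν.ord d) (hx : c • x ∈ M) : d • x ∈ M := by
  have h1 : d * c⁻¹ ∈ ν.integers := by
    rw [mem_integers_iff (mul_ne_zero hd (inv_ne_zero hc)), ord_mul hd (inv_ne_zero hc), ord_inv]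
    omega
  have := M.smul_mem ⟨_, h1⟩ hx
  rwa [integers_smul_def, smul_smul, inv_mul_cancel_right₀ hc] at this

theorem mem_smul_iff {M : Submodule ν.integers (Fin n → K)} {c : K} (hc : c ≠ 0)
    {x : Fin n → K} : x ∈ c • M ↔ c⁻¹ • x ∈ M := by
  rw [Submodule.mem_smul_pointwise_iff_exists]
  constructor
  · rintro ⟨y, hy, rfl⟩
    rwa [smul_smul, inv_mul_cancel₀ hc, one_smul]
  · intro h
    exact ⟨_, h, by rw [smul_smul, mul_inv_cancel₀ hc, one_smul]⟩

theorem mem_zpow_smul_iff {M : Submodule ν.integers (Fin n → K)} {k : ℤ} {x : Fin n → K} :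
    x ∈ ν.uniformizer ^ k • M ↔ ν.uniformizer ^ (-k) • x ∈ M := by
  rw [mem_smul_iff (uniformizer_zpow_ne_zero k), zpow_neg]

theorem smul_eq_zpow_smul (M : Submodule ν.integers (Fin n → K)) {c : K} (hc : c ≠ 0) :
    c • M = ν.uniformizer ^ ν.ord c • M := by
  ext x
  rw [mem_smul_iff hc, mem_zpow_smul_iff]
  constructor <;>
  · apply mem_of_smul_mem
    · simp [hc, uniformizer_zpow_ne_zero]
    · simp [hc, uniformizer_zpow_ne_zero]
    · simp

theorem zpow_smul_le_zpow_smul (M : Submodule ν.integers (Fin n → K)) {k l : ℤ} (h : k ≤ l) :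
    ν.uniformizer ^ l • M ≤ ν.uniformizer ^ k • M := by
  intro x
  rw [mem_zpow_smul_iff, mem_zpow_smul_iff]
  apply mem_of_smul_mem (uniformizer_zpow_ne_zero _) (uniformizer_zpow_ne_zero _)
  simpa using h

theorem zpow_smul_zpow_smul (M : Submodule ν.integers (Fin n → K)) (k l : ℤ) :
    ν.uniformizer ^ k • ν.uniformizer ^ l • M = ν.uniformizer ^ (k + l) • M := by
  rw [smul_smul, zpow_add₀ uniformizer_ne_zero]

/-! ### Lattices with a given basis -/

theorem isLattice_span (b : Module.Basis (Fin n) K (Fin n → K)) (a : Fin n → ℤ) :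
    (Submodule.span ν.integers
      (Set.range fun i => ν.uniformizer ^ (-a i) • b i)).IsLattice K where
  fg := Submodule.fg_span (Set.finite_range _)
  span_eq_top := by
    rw [Submodule.span_span_of_tower, eq_top_iff, ← b.span_eq, Submodule.span_le]
    rintro _ ⟨i, rfl⟩
    have : b i = ν.uniformizer ^ (a i) • ν.uniformizer ^ (-a i) • b i := by
      rw [smul_smul, ← zpow_add₀ uniformizer_ne_zero]
      simp
    rw [this]
    exact Submodule.smul_mem _ _ (Submodule.subset_span ⟨i, rfl⟩)

variable (ν) in
/-- The lattice spanned by the vectors `π ^ (-aᵢ) bᵢ`. -/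
def latticeOf (b : Module.Basis (Fin n) K (Fin n → K)) (a : Fin n → ℤ) : ν.Lattice n :=
  ⟨_, isLattice_span b a⟩

/-- Vanishing coordinates impose no condition and must be excluded, since `ord 0` is the default
value `0` instead of infinity. -/
theorem mem_latticeOf_iff {b : Module.Basis (Fin n) K (Fin n → K)} {a : Fin n → ℤ}
    {x : Fin n → K} :
    x ∈ (ν.latticeOf b a).1 ↔ ∀ i, b.repr x i ≠ 0 → 0 ≤ ν.ord (b.repr x i) + a i := by
  have key : x ∈ (ν.latticeOf b a).1 ↔
      ∀ i, b.repr x i * ν.uniformizer ^ (a i) ∈ ν.integers := by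
    rw [latticeOf, Submodule.mem_span_range_iff_exists_fun]
    constructor
    · rintro ⟨c, rfl⟩ i
      have : b.repr (∑ i, c i • ν.uniformizer ^ (-a i) • b i) i =
          (c i : K) * ν.uniformizer ^ (-a i) := by
        simp_rw [integers_smul_def, smul_smul]
        rw [b.repr_sum_self]
      rw [this, mul_assoc, ← zpow_add₀ uniformizer_ne_zero]
      simp
    · intro h
      refine ⟨fun i => ⟨_, h i⟩, ?_⟩
      refine (Finset.sum_congr rfl fun i _ => ?_).trans (b.sum_repr x)
      rw [integers_smul_def, smul_smul, mul_assoc, ← zpow_add₀ uniformizer_ne_zero]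
      simp
  rw [key]
  refine forall_congr' fun i => ?_
  by_cases h : b.repr x i = 0
  · simp [h]
  · rw [mem_integers_iff (mul_ne_zero h (uniformizer_zpow_ne_zero _)),
      ord_mul h (uniformizer_zpow_ne_zero _), ord_uniformizer_zpow]
    simp [h]

theorem zpow_smul_mem_latticeOf_iff {b : Module.Basis (Fin n) K (Fin n → K)} {a : Fin n → ℤ}
    {x : Fin n → K} {k : ℤ} :
    ν.uniformizer ^ k • x ∈ (ν.latticeOf b a).1 ↔
      ∀ i, b.repr x i ≠ 0 → 0 ≤ ν.ord (b.repr x i) + a i + k := by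
  rw [mem_latticeOf_iff]
  refine forall_congr' fun i => ?_
  by_cases h : b.repr x i = 0
  · simp [h]
  · simp only [map_smul, Finsupp.coe_smul, Pi.smul_apply, smul_eq_mul, ne_eq, h, not_false_eq_true,
      forall_true_left, mul_eq_zero, uniformizer_zpow_ne_zero, or_self]
    rw [ord_mul (uniformizer_zpow_ne_zero _) h, ord_uniformizer_zpow]
    constructor <;> intro _ <;> omega

theorem zpow_smul_latticeOf (b : Module.Basis (Fin n) K (Fin n → K)) (a : Fin n → ℤ) (k : ℤ) :
    ν.uniformizer ^ k • (ν.latticeOf b a).1 = (ν.latticeOf b fun i => a i - k).1 := by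
  ext x
  rw [mem_zpow_smul_iff, zpow_smul_mem_latticeOf_iff, mem_latticeOf_iff]
  refine forall_congr' fun i => ?_
  constructor <;> intro h h' <;> have := h h' <;> omega

theorem latticeOf_le_iff {b : Module.Basis (Fin n) K (Fin n → K)} {a a' : Fin n → ℤ} :
    (ν.latticeOf b a).1 ≤ (ν.latticeOf b a').1 ↔ ∀ i, a i ≤ a' i := by
  constructor
  · intro h i
    have h1 : ν.uniformizer ^ (-a i) • b i ∈ (ν.latticeOf b a).1 :=
      Submodule.subset_span ⟨i, rfl⟩
    have := zpow_smul_mem_latticeOf_iff.mp (h h1) i (by simp)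
    simp at this
    omega
  · intro h x hx
    rw [mem_latticeOf_iff] at hx ⊢
    intro i hi
    have := hx i hi
    have := h i
    omega

/-- A lattice is free of rank `n` over the principal ring of integers, and a basis of it is also a
`K`-basis of the ambient space. -/
theorem Lattice.exists_eq_latticeOf (L : ν.Lattice n) :
    ∃ b : Module.Basis (Fin n) K (Fin n → K), L = ν.latticeOf b fun _ => 0 := by
  have : L.1.IsLattice K := L.2
  have : Module.Free ν.integers L.1 := Submodule.IsLattice.free K L.1
  have hr := Submodule.IsLattice.finrank_of_pi K L.1
  rw [Fintype.card_fin] at hr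
  let b := Module.finBasisOfFinrankEq ν.integers L.1 hr
  refine ⟨b.extendOfIsLattice K, Subtype.ext ?_⟩
  simp only [latticeOf, neg_zero, zpow_zero, one_smul,
    Module.Basis.extendOfIsLattice_apply]
  have h := congrArg (Submodule.map L.1.subtype) b.span_eq
  rw [Submodule.map_span, Submodule.map_top, Submodule.range_subtype, ← Set.range_comp] at h
  exact h.symm

/-! ### The level of a vector with respect to a lattice -/

namespace Lattice

/-- The largest `k` such that `e` lies in `π ^ k L`, for a nonzero vector `e`. -/
def level (L : ν.Lattice n) (e : Fin n → K) : ℤ := sSup {k | ν.uniformizer ^ (-k) • e ∈ L.1}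

/-- In a basis of the lattice, the bound is the least order of a nonzero coordinate of `e`. -/
theorem exists_isGreatest_level (L : ν.Lattice n) {e : Fin n → K} (he : e ≠ 0) :
    ∃ m : ℤ, ∀ k : ℤ, ν.uniformizer ^ (-k) • e ∈ L.1 ↔ k ≤ m := by
  obtain ⟨b, rfl⟩ := L.exists_eq_latticeOf
  classical
  have hne : (Finset.univ.filter fun i => b.repr e i ≠ 0).Nonempty := by
    by_contra h
    rw [Finset.not_nonempty_iff_eq_empty, Finset.filter_eq_empty_iff] at h
    apply he
    apply b.repr.injective
    ext i
    simpa using h (Finset.mem_univ i)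
  obtain ⟨i, hi, hmin⟩ := Finset.exists_min_image _ (fun i => ν.ord (b.repr e i)) hne
  simp only [Finset.mem_filter, Finset.mem_univ, true_and] at hi hmin
  refine ⟨ν.ord (b.repr e i), fun k => ?_⟩
  rw [zpow_smul_mem_latticeOf_iff]
  constructor
  · intro h
    have := h i hi
    omega
  · intro h j hj
    have := hmin j hj
    omega

theorem le_level_iff (L : ν.Lattice n) {e : Fin n → K} (he : e ≠ 0) {k : ℤ} :
    k ≤ L.level e ↔ ν.uniformizer ^ (-k) • e ∈ L.1 := by
  obtain ⟨m, hm⟩ := L.exists_isGreatest_level he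
  have : L.level e = m := by
    have h : {k : ℤ | ν.uniformizer ^ (-k) • e ∈ L.1} = Set.Iic m := by
      ext k
      exact hm k
    rw [level, h, csSup_Iic]
  rw [this, hm]

theorem mem_iff_level (L : ν.Lattice n) {e : Fin n → K} (he : e ≠ 0) :
    e ∈ L.1 ↔ 0 ≤ L.level e := by
  rw [L.le_level_iff he]
  simp

theorem level_eq_of_forall (L : ν.Lattice n) {e : Fin n → K} (he : e ≠ 0) {m : ℤ}
    (h : ∀ k : ℤ, ν.uniformizer ^ (-k) • e ∈ L.1 ↔ k ≤ m) : L.level e = m := by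
  apply le_antisymm
  · rw [← h, ← L.le_level_iff he]
  · rw [L.le_level_iff he, h]

variable (L : ν.Lattice n)

/-- The homothetic lattice `π ^ k L`. -/
def shift (L : ν.Lattice n) (k : ℤ) : ν.Lattice n :=
  ⟨ν.uniformizer ^ k • L.1, by
    obtain ⟨b, rfl⟩ := L.exists_eq_latticeOf
    rw [zpow_smul_latticeOf]
    exact (ν.latticeOf b _).2⟩

theorem shift_val (k : ℤ) : (L.shift k).1 = ν.uniformizer ^ k • L.1 := rfl

theorem mem_shift_iff {k : ℤ} {x : Fin n → K} :
    x ∈ (L.shift k).1 ↔ ν.uniformizer ^ (-k) • x ∈ L.1 := mem_zpow_smul_iff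

theorem toVertex_shift (k : ℤ) : (L.shift k).toVertex = L.toVertex :=
  (Quotient.sound (s := homothety) ⟨ν.uniformizer ^ k, uniformizer_zpow_ne_zero _, rfl⟩ :
    Quotient.mk _ L = Quotient.mk _ (L.shift k)).symm

theorem shift_shift (k l : ℤ) : (L.shift k).shift l = L.shift (l + k) :=
  Subtype.ext (zpow_smul_zpow_smul _ _ _)

@[simp] theorem shift_zero : L.shift 0 = L := by
  apply Subtype.ext
  rw [shift_val, zpow_zero, one_smul]

theorem toVertex_eq_iff {L M : ν.Lattice n} :
    L.toVertex = M.toVertex ↔ ∃ k : ℤ, M = L.shift k := by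
  constructor
  · intro h
    obtain ⟨c, hc, h⟩ := Quotient.exact h
    exact ⟨ν.ord c, Subtype.ext (h.trans (smul_eq_zpow_smul _ hc))⟩
  · rintro ⟨k, rfl⟩
    exact (L.toVertex_shift k).symm

theorem level_shift (k : ℤ) {e : Fin n → K} (he : e ≠ 0) :
    (L.shift k).level e = L.level e - k := by
  apply level_eq_of_forall _ he
  intro l
  rw [mem_shift_iff, smul_smul, ← zpow_add₀ uniformizer_ne_zero, ← neg_add, ← L.le_level_iff he]
  omega

/-- A lattice is determined by its level function, so inclusions between homothets become integer
inequalities, which is how they are handled from here on. -/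
theorem le_shift_iff {L M : ν.Lattice n} {k : ℤ} :
    L.1 ≤ (M.shift k).1 ↔ ∀ e, e ≠ 0 → L.level e + k ≤ M.level e := by
  constructor
  · intro h e he
    have h1 := (L.le_level_iff he).mp le_rfl
    have h2 := h h1
    rw [mem_shift_iff, smul_smul, ← zpow_add₀ uniformizer_ne_zero, ← neg_add,
      ← M.le_level_iff he] at h2
    omega
  · intro h e hL
    by_cases he : e = 0
    · rw [he]
      exact zero_mem _
    rw [mem_shift_iff, ← M.le_level_iff he]
    have := h e he
    rw [L.mem_iff_level he] at hL
    omega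

theorem le_iff_level {L M : ν.Lattice n} : L.1 ≤ M.1 ↔ ∀ e, e ≠ 0 → L.level e ≤ M.level e := by
  simpa using le_shift_iff (L := L) (M := M) (k := 0)

theorem level_smul {c : K} (hc : c ≠ 0) {e : Fin n → K} (he : e ≠ 0) :
    L.level (c • e) = ν.ord c + L.level e := by
  apply level_eq_of_forall _ (smul_ne_zero hc he)
  intro k
  have : ν.uniformizer ^ (-k) • c • e ∈ L.1 ↔ ν.uniformizer ^ (-(k - ν.ord c)) • e ∈ L.1 := by
    rw [smul_smul]
    have h : ν.ord (ν.uniformizer ^ (-k) * c) = ν.ord (ν.uniformizer ^ (-(k - ν.ord c))) := by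
      rw [ord_mul (uniformizer_zpow_ne_zero _) hc, ord_uniformizer_zpow, ord_uniformizer_zpow]
      ring
    have h1 := mul_ne_zero (uniformizer_zpow_ne_zero (ν := ν) (-k)) hc
    exact ⟨mem_of_smul_mem h1 (uniformizer_zpow_ne_zero _) h.le,
      mem_of_smul_mem (uniformizer_zpow_ne_zero _) h1 h.ge⟩
  rw [this, ← L.le_level_iff he]
  omega

end Lattice

end DiscreteValuation

/-! ### Bases adapted to chains of submodules -/

theorem Finset.exists_forall_le_of_chain {α : Type*} [PartialOrder α] (S : Finset α)
    (hS : S.Nonempty) (h : ∀ x ∈ S, ∀ y ∈ S, x ≤ y ∨ y ≤ x) : ∃ m ∈ S, ∀ x ∈ S, x ≤ m := by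
  obtain ⟨m, hm⟩ := S.exists_maximal hS
  refine ⟨m, hm.1, fun x hx => ?_⟩
  rcases h x hx m hm.1 with h | h
  · exact h
  · exact hm.2 hx h

/-- Induction on the chain: with `s` adapted to all members but the largest one `W₀`, extend `s ∩
W₀` to a basis of `W₀`; the smaller members keep their spanning sets. -/
theorem exists_linearIndepOn_adapted {k V : Type*} [Field k] [AddCommGroup V] [Module k V]
    (S : Finset (Submodule k V)) (h : ∀ W ∈ S, ∀ W' ∈ S, W ≤ W' ∨ W' ≤ W) :
    ∃ s : Set V, LinearIndepOn k id s ∧ ∀ W ∈ S, Submodule.span k (s ∩ W) = W := by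
  classical
  induction hc : S.card generalizing S with
  | zero =>
    rw [Finset.card_eq_zero] at hc
    subst hc
    exact ⟨∅, linearIndepOn_empty _ _, by simp⟩
  | succ m ih =>
    have hne : S.Nonempty := by
      rw [← Finset.card_pos]
      omega
    obtain ⟨W₀, h0, hmax⟩ := S.exists_forall_le_of_chain hne h
    obtain ⟨s, hs, hs'⟩ := ih (S.erase W₀)
      (fun W hW W' hW' => h W (Finset.mem_of_mem_erase hW) W' (Finset.mem_of_mem_erase hW'))
      (by rw [Finset.card_erase_of_mem h0]; omega)
    obtain ⟨t, ht1, ht2, ht3, ht4⟩ := exists_linearIndepOn_id_extension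
      (hs.mono Set.inter_subset_left : LinearIndepOn k id (s ∩ (W₀ : Set V)))
      Set.inter_subset_right
    refine ⟨t, ht4, fun W hW => ?_⟩
    apply le_antisymm (Submodule.span_le.mpr Set.inter_subset_right)
    by_cases hWW : W = W₀
    · subst hWW
      rw [Set.inter_eq_left.mpr ht1]
      exact ht3
    · conv_lhs => rw [← hs' W (Finset.mem_erase.mpr ⟨hWW, hW⟩)]
      apply Submodule.span_mono
      exact fun x hx => ⟨ht2 ⟨hx.1, hmax W hW hx.2⟩, hx.2⟩

theorem exists_basis_adapted {k : Type*} [Field k] {n : ℕ}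
    (S : Finset (Submodule k (Fin n → k))) (h : ∀ W ∈ S, ∀ W' ∈ S, W ≤ W' ∨ W' ≤ W) :
    ∃ b : Module.Basis (Fin n) k (Fin n → k),
      ∀ W ∈ S, ∀ x, x ∈ W ↔ ∀ i, b i ∈ W ∨ b.repr x i = 0 := by
  classical
  obtain ⟨s, hs, hs'⟩ := exists_linearIndepOn_adapted (insert ⊤ S) (by
    intro W hW W' hW'
    rcases Finset.mem_insert.mp hW with rfl | hW
    · exact Or.inr le_top
    rcases Finset.mem_insert.mp hW' with rfl | hW'
    · exact Or.inl le_top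
    exact h W hW W' hW')
  have htop := hs' ⊤ (Finset.mem_insert_self _ _)
  simp only [Submodule.top_coe, Set.inter_univ] at htop
  let b₀ : Module.Basis s k (Fin n → k) := Module.Basis.mk hs (by simp [htop])
  have hfin : Finite s := Module.Finite.finite_basis b₀
  have hcard : Nat.card s = n := by
    rw [← Module.finrank_eq_nat_card_basis b₀]
    simp
  let e : s ≃ Fin n := Finite.equivFinOfCardEq hcard
  refine ⟨b₀.reindex e, fun W hW x => ⟨fun hx i => ?_, fun hx => ?_⟩⟩
  · refine or_iff_not_imp_left.mpr fun h1 => ?_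
    rw [← hs' W (Finset.mem_insert_of_mem hW)] at hx
    induction hx using Submodule.span_induction with
    | mem y hy =>
      have hy' : y = b₀ ⟨y, hy.1⟩ := by simp [b₀]
      rw [hy', Module.Basis.repr_reindex_apply, Module.Basis.repr_self,
        Finsupp.single_apply, if_neg]
      intro hcon
      apply h1
      rw [Module.Basis.reindex_apply, ← hcon, ← hy']
      exact hy.2
    | zero => simp
    | add y z _ _ hy hz => rw [map_add, Finsupp.add_apply, hy, hz, add_zero]
    | smul c y _ hy => rw [map_smul, Finsupp.smul_apply, hy, smul_zero]
  · rw [← (b₀.reindex e).sum_repr x]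
    refine W.sum_mem fun i _ => ?_
    rcases hx i with h | h
    · exact W.smul_mem _ h
    · rw [h, zero_smul]
      exact W.zero_mem

/-- Coordinatewise reduction modulo the maximal ideal. -/
def IsLocalRing.residuePi (R : Type*) [CommRing R] [IsLocalRing R] (n : ℕ) :
    (Fin n → R) →ₛₗ[IsLocalRing.residue R] (Fin n → IsLocalRing.ResidueField R) where
  toFun x i := IsLocalRing.residue R (x i)
  map_add' x y := by ext i; simp
  map_smul' c x := by ext i; simp

/-- Submodules containing all vectors with entries in the maximal ideal are the preimages of their
reductions. So a basis adapted to the reduced chain over the residue field is lifted. -/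
theorem IsLocalRing.exists_basis_adapted {R : Type*} [CommRing R] [IsLocalRing R] {n : ℕ}
    (S : Finset (Submodule R (Fin n → R))) (h : ∀ N ∈ S, ∀ N' ∈ S, N ≤ N' ∨ N' ≤ N)
    (hm : ∀ N ∈ S, ∀ x : Fin n → R, (∀ i, x i ∈ maximalIdeal R) → x ∈ N) :
    ∃ b : Module.Basis (Fin n) R (Fin n → R),
      ∀ N ∈ S, ∀ x, x ∈ N ↔ ∀ i, b i ∈ N ∨ b.repr x i ∈ maximalIdeal R := by
  classical
  have : RingHomSurjective (residue R) := ⟨residue_surjective⟩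
  let ρ := residuePi R n
  have hρ : ∀ x i, ρ x i = residue R (x i) := fun _ _ => rfl
  have hmem : ∀ N ∈ S, ∀ x, ρ x ∈ N.map ρ ↔ x ∈ N := by
    intro N hN x
    refine ⟨?_, fun hx => Submodule.mem_map_of_mem hx⟩
    rintro ⟨y, hy, hxy⟩
    have : x - y ∈ N := by
      apply hm N hN
      intro i
      rw [← residue_eq_zero_iff, Pi.sub_apply, map_sub, ← hρ, ← hρ, hxy, sub_self]
    simpa using N.add_mem this hy
  obtain ⟨β, hβ⟩ := _root_.exists_basis_adapted (S.image (Submodule.map ρ)) (by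
    simp only [Finset.forall_mem_image]
    exact fun N hN N' hN' => (h N hN N' hN').imp (Submodule.map_mono ·) (Submodule.map_mono ·))
  have hsurj : ∀ y, ∃ x, ρ x = y := by
    intro y
    choose x hx using fun i => residue_surjective (y i)
    exact ⟨x, funext hx⟩
  choose c hc using fun i => hsurj (β i)
  -- Any lift of a basis is a basis: its determinant is nonzero in the residue field, hence a unit.
  have hunit : IsUnit ((Pi.basisFun R (Fin n)).det c) := by
    have h1 := ((Pi.basisFun (ResidueField R) (Fin n)).is_basis_iff_det (v := β)).mp
      ⟨β.linearIndependent, β.span_eq⟩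
    rw [Module.Basis.det_apply] at h1 ⊢
    rw [← isUnit_map_iff (residue R), RingHom.map_det]
    convert h1 using 2
    ext i j
    simp [Module.Basis.toMatrix_apply, ← hρ, hc]
  obtain ⟨h1, h2⟩ := ((Pi.basisFun R (Fin n)).is_basis_iff_det).mpr hunit
  let b := Module.Basis.mk h1 h2.ge
  have hb : ∀ i, ρ (b i) = β i := by
    intro i
    rw [Module.Basis.mk_apply, hc]
  have hrepr : ∀ x i, β.repr (ρ x) i = residue R (b.repr x i) := by
    intro x i
    conv_lhs => rw [← b.sum_repr x]
    rw [map_sum]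
    simp only [LinearMap.map_smulₛₗ, hb]
    rw [β.repr_sum_self]
  refine ⟨b, fun N hN x => ?_⟩
  rw [← hmem N hN x, hβ _ (Finset.mem_image_of_mem _ hN)]
  refine forall_congr' fun i => ?_
  rw [← hb, hmem N hN, hrepr, residue_eq_zero_iff]

namespace DiscreteValuation

variable {K : Type*} [Field K] {ν : DiscreteValuation K} {n : ℕ}

theorem mem_maximalIdeal_iff {x : ν.integers} :
    x ∈ IsLocalRing.maximalIdeal ν.integers ↔ ((x : K) ≠ 0 → 1 ≤ ν.ord x) := by
  rw [IsLocalRing.mem_maximalIdeal, mem_nonunits_iff, ν.integers.valuation_eq_one_iff]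
  by_cases hx : (x : K) = 0
  · simp [hx]
  · have h1 := (mem_integers_iff hx).mp x.2
    have h2 : ν.integers.valuation (x : K) = 1 ↔ ν.val x = 1 :=
      (Valuation.isEquiv_iff_val_eq_one.mp ν.val.isEquiv_valuation_valuationSubring).symm
    rw [h2, val_eq_exp hx, WithZero.exp_eq_one]
    constructor
    · intro h _
      omega
    · intro h
      have := h hx
      omega

/-- After identifying `M` with the standard free module, this is the local ring statement. A basis
vector in `N` gets exponent `0`; for the others only the multiple by the uniformizer lies in `N`,
which is exponent `-1`. -/
theorem Lattice.exists_basis_adapted (M : ν.Lattice n)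
    (S : Finset (Submodule ν.integers (Fin n → K)))
    (h : ∀ N ∈ S, ∀ N' ∈ S, N ≤ N' ∨ N' ≤ N) (h1 : ∀ N ∈ S, N ≤ M.1)
    (h2 : ∀ N ∈ S, ν.uniformizer • M.1 ≤ N) :
    ∃ b : Module.Basis (Fin n) K (Fin n → K),
      ∀ N ∈ S, ∃ a : Fin n → ℤ, N = (ν.latticeOf b a).1 := by
  classical
  have : M.1.IsLattice K := M.2
  have : Module.Free ν.integers M.1 := Submodule.IsLattice.free K M.1
  have hr := Submodule.IsLattice.finrank_of_pi K M.1
  rw [Fintype.card_fin] at hr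
  let b₀ := Module.finBasisOfFinrankEq ν.integers M.1 hr
  let f : (Fin n → ν.integers) →ₗ[ν.integers] (Fin n → K) :=
    M.1.subtype ∘ₗ b₀.equivFun.symm.toLinearMap
  obtain ⟨γ, hγ⟩ := IsLocalRing.exists_basis_adapted (S.image (Submodule.comap f)) (by
    simp only [Finset.forall_mem_image]
    exact fun N hN N' hN' => (h N hN N' hN').imp (Submodule.comap_mono ·)
      (Submodule.comap_mono ·)) (by
    simp only [Finset.forall_mem_image]
    intro N hN x hx
    apply h2 N hN
    have hfx : f x = ∑ i, x i • (b₀ i : Fin n → K) := by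
      simp [f, Module.Basis.equivFun_symm_apply]
    rw [hfx]
    refine Submodule.sum_mem _ fun i _ => ?_
    rw [mem_smul_iff uniformizer_ne_zero, integers_smul_def, smul_smul]
    by_cases hxi : (x i : K) = 0
    · simp [hxi]
    refine mem_of_smul_mem one_ne_zero (mul_ne_zero (inv_ne_zero uniformizer_ne_zero) hxi) ?_
      (show (1 : K) • (b₀ i : Fin n → K) ∈ M.1 by rw [one_smul]; exact (b₀ i).2)
    have := mem_maximalIdeal_iff.mp (hx i) hxi
    have h3 := ord_uniformizer_zpow (ν := ν) 1
    rw [zpow_one] at h3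
    rw [ord_mul (inv_ne_zero uniformizer_ne_zero) hxi, ord_inv, h3, ord_one]
    omega)
  let b := (γ.map b₀.equivFun.symm).extendOfIsLattice K
  have hb : ∀ i, b i = f (γ i) := fun i => by simp [b, f]
  refine ⟨b, fun N hN => ⟨fun i => if γ i ∈ N.comap f then 0 else -1, ?_⟩⟩
  have hrepr : ∀ x i, b.repr (f x) i = (γ.repr x i : K) := by
    intro x i
    conv_lhs => rw [← γ.sum_repr x]
    rw [map_sum]
    simp only [LinearMap.map_smul, integers_smul_def, ← hb]
    rw [b.repr_sum_self]
  have hf : ∀ x, f x ∈ N ↔ f x ∈ (ν.latticeOf b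
      fun i => if γ i ∈ N.comap f then 0 else -1).1 := by
    intro x
    rw [← Submodule.mem_comap, hγ _ (Finset.mem_image_of_mem _ hN), mem_latticeOf_iff]
    refine forall_congr' fun i => ?_
    rw [mem_maximalIdeal_iff, hrepr]
    by_cases hi : γ i ∈ N.comap f
    · simp only [hi, true_or, if_true, true_iff, add_zero]
      exact fun h => (mem_integers_iff h).mp (γ.repr x i).2
    · simp only [hi, false_or, if_false]
      constructor <;> intro h h' <;> have := h h' <;> omega
  have hfs : ∀ y ∈ M.1, ∃ x, f x = y := fun y hy => ⟨b₀.equivFun ⟨y, hy⟩, by simp [f]⟩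
  apply le_antisymm
  · intro y hy
    obtain ⟨x, rfl⟩ := hfs y (h1 N hN hy)
    exact (hf x).mp hy
  · intro y hy
    have : y ∈ M.1 := by
      refine Submodule.span_le.mpr ?_ hy
      rintro _ ⟨i, rfl⟩
      refine mem_of_smul_mem one_ne_zero (uniformizer_zpow_ne_zero _) ?_
        ((one_smul K (b i)).symm ▸ hb i ▸ (b₀.equivFun.symm (γ i)).2)
      rw [ord_one, ord_uniformizer_zpow]
      dsimp only
      split_ifs <;> omega
    obtain ⟨x, rfl⟩ := hfs y this
    exact (hf x).mpr hy

end DiscreteValuation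

namespace DiscreteValuation

variable {K : Type*} [Field K] {ν : DiscreteValuation K} {n : ℕ}

/-! ### Coordinates on a simplex and the dimension of the building -/

theorem uniformizer_smul_eq (M : Submodule ν.integers (Fin n → K)) :
    ν.uniformizer • M = ν.uniformizer ^ (1 : ℤ) • M := by rw [zpow_one]

theorem latticeOf_shift (b : Module.Basis (Fin n) K (Fin n → K)) (a : Fin n → ℤ) (k : ℤ) :
    (ν.latticeOf b a).shift k = ν.latticeOf b fun i => a i - k :=
  Subtype.ext (zpow_smul_latticeOf b a k)

/-- The coordinate vectors, in a common apartment, of a chain of lattices that represents a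
simplex. -/
structure IsChain (s : Finset (ν.Vertex n)) (a : ν.Vertex n → Fin n → ℤ) : Prop where
  total : ∀ v ∈ s, ∀ w ∈ s, (∀ i, a v i ≤ a w i) ∨ ∀ i, a w i ≤ a v i
  le_add_one : ∀ v ∈ s, ∀ w ∈ s, ∀ i, a w i ≤ a v i + 1

theorem isChain_of_rep {s : Finset (ν.Vertex n)} {rep : ν.Vertex n → ν.Lattice n}
    (h1 : ∀ v ∈ s, ∀ w ∈ s, (rep v).1 ≤ (rep w).1 ∨ (rep w).1 ≤ (rep v).1)
    (h2 : ∀ v ∈ s, ∀ w ∈ s, ν.uniformizer • (rep v).1 ≤ (rep w).1)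
    {b : Module.Basis (Fin n) K (Fin n → K)} {a : ν.Vertex n → Fin n → ℤ}
    (ha : ∀ v ∈ s, rep v = ν.latticeOf b (a v)) : IsChain s a where
  total v hv w hw := by
    have := h1 v hv w hw
    rwa [ha v hv, ha w hw, latticeOf_le_iff, latticeOf_le_iff] at this
  le_add_one v hv w hw i := by
    have := h2 w hw v hv
    rw [ha v hv, ha w hw, uniformizer_smul_eq, zpow_smul_latticeOf, latticeOf_le_iff] at this
    have := this i
    omega

theorem IsSimplex.exists_coordinates {s : Finset (ν.Vertex n)} (hs : IsSimplex s) :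
    ∃ (b : Module.Basis (Fin n) K (Fin n → K)) (a : ν.Vertex n → Fin n → ℤ),
      (∀ v ∈ s, (ν.latticeOf b (a v)).toVertex = v) ∧ IsChain s a := by
  classical
  obtain ⟨hne, rep, h0, h1, h2⟩ := hs
  have hS : ∀ N ∈ s.image fun v => (rep v).1, ∀ N' ∈ s.image fun v => (rep v).1,
      N ≤ N' ∨ N' ≤ N := by
    simp only [Finset.forall_mem_image]
    exact h1
  obtain ⟨M, hM, hmax⟩ := Finset.exists_forall_le_of_chain _ (hne.image _) hS
  obtain ⟨v₀, hv₀, rfl⟩ := Finset.mem_image.mp hM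
  obtain ⟨b, hb⟩ := (rep v₀).exists_basis_adapted _ hS hmax (by
    simp only [Finset.forall_mem_image]
    exact fun v hv => h2 v₀ hv₀ v hv)
  have hb' : ∀ v, ∃ a : Fin n → ℤ, v ∈ s → rep v = ν.latticeOf b a := by
    intro v
    by_cases hv : v ∈ s
    · obtain ⟨a, ha⟩ := hb _ (Finset.mem_image_of_mem _ hv)
      exact ⟨a, fun _ => Subtype.ext ha⟩
    · exact ⟨0, fun h => absurd h hv⟩
  choose a ha' using hb'
  exact ⟨b, a, fun v hv => by rw [← ha' v hv, h0 v hv], isChain_of_rep h1 h2 ha'⟩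

/-- The apartment in `IsSegment` is arbitrary, and coordinates there are only defined up to
constants; the representatives forming a chain are homothets, so a constant per vertex corrects the
coordinates. -/
theorem IsSimplex.exists_isChain_add {s : Finset (ν.Vertex n)} (hs : IsSimplex s)
    {b : Module.Basis (Fin n) K (Fin n → K)} {a : ν.Vertex n → Fin n → ℤ}
    (ha : ∀ v ∈ s, (ν.latticeOf b (a v)).toVertex = v) :
    ∃ k : ν.Vertex n → ℤ, IsChain s fun v i => a v i - k v := by
  obtain ⟨hne, rep, h0, h1, h2⟩ := hs
  have : ∀ v ∈ s, ∃ k : ℤ, rep v = (ν.latticeOf b (a v)).shift k := fun v hv =>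
    Lattice.toVertex_eq_iff.mp ((ha v hv).trans (h0 v hv).symm)
  choose! k hk using this
  refine ⟨k, isChain_of_rep (b := b) h1 h2 fun v hv => ?_⟩
  rw [hk v hv, latticeOf_shift]

theorem toVertex_latticeOf_eq_iff {b : Module.Basis (Fin n) K (Fin n → K)} {a a' : Fin n → ℤ} :
    (ν.latticeOf b a).toVertex = (ν.latticeOf b a').toVertex ↔ ∃ k, ∀ i, a' i = a i - k := by
  rw [Lattice.toVertex_eq_iff]
  refine exists_congr fun k => ?_
  rw [latticeOf_shift]
  constructor
  · intro h i
    have := congrArg Subtype.val h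
    exact le_antisymm (latticeOf_le_iff.mp this.le i) (latticeOf_le_iff.mp this.ge i)
  · intro h
    rw [funext h]

/-- In a chain the coordinate sum determines the vertex, and the sums lie in a half-open interval of
length `n`. -/
theorem IsSimplex.card_le {s : Finset (ν.Vertex n)} (hs : IsSimplex s) (hn : 1 ≤ n) :
    s.card ≤ n := by
  obtain ⟨b, a, ha, hchain⟩ := hs.exists_coordinates
  obtain ⟨v₀, hv₀, hmin⟩ := Finset.exists_min_image s (fun v => ∑ i, a v i) hs.1
  have hle : ∀ v ∈ s, ∀ w ∈ s, ∑ i, a v i ≤ ∑ i, a w i → ∀ i, a v i ≤ a w i := by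
    intro v hv w hw h
    rcases hchain.total v hv w hw with h' | h'
    · exact h'
    · have heq := (Finset.sum_eq_sum_iff_of_le fun i _ => h' i).mp
        (le_antisymm (Finset.sum_le_sum fun i _ => h' i) h)
      exact fun i => (heq i (Finset.mem_univ i)).ge
  have hmaps : ∀ v ∈ s, ∑ i, a v i ∈ Finset.Ico (∑ i, a v₀ i) (∑ i, a v₀ i + n) := by
    intro v hv
    rw [Finset.mem_Ico]
    refine ⟨hmin v hv, ?_⟩
    by_contra hcon
    push Not at hcon
    have hub : ∀ i ∈ Finset.univ, a v i ≤ a v₀ i + 1 :=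
      fun i _ => hchain.le_add_one v₀ hv₀ v hv i
    have hsum : ∑ i, (a v₀ i + 1) = ∑ i, a v₀ i + n := by
      rw [Finset.sum_add_distrib]
      simp
    have heq := (Finset.sum_eq_sum_iff_of_le hub).mp
      (le_antisymm (Finset.sum_le_sum hub) (hsum ▸ hcon))
    -- The extreme sum forces every coordinate to grow by exactly `1`, which is a homothety.
    have hvv : v = v₀ := by
      rw [← ha v hv, ← ha v₀ hv₀, toVertex_latticeOf_eq_iff]
      refine ⟨1, fun i => ?_⟩
      have := heq i (Finset.mem_univ i)
      omega
    subst hvv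
    omega
  have hinj : Set.InjOn (fun v => ∑ i, a v i) s := by
    intro v hv w hw h
    rw [← ha v hv, ← ha w hw]
    congr 2
    funext i
    exact le_antisymm (hle v hv w hw h.le i) (hle w hw v hv h.ge i)
  have := Finset.card_le_card_of_injOn _ hmaps hinj
  simpa using this

theorem exists_isSimplex_card (ν : DiscreteValuation K) (hn : 1 ≤ n) :
    ∃ s : Finset (ν.Vertex n), IsSimplex s ∧ s.card = n := by
  classical
  let b := Pi.basisFun K (Fin n)
  let a : Fin n → Fin n → ℤ := fun i j => if j < i then 1 else 0
  let V : Fin n → ν.Vertex n := fun i => (ν.latticeOf b (a i)).toVertex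
  have hinj : Function.Injective V := by
    have key : ∀ i i' : Fin n, i < i' → V i ≠ V i' := by
      intro i i' hii h
      obtain ⟨k, hk⟩ := toVertex_latticeOf_eq_iff.mp h
      -- The last coordinate is `0` for every member of the flag, so the homothety exponent is `0`;
      -- coordinate `i` then distinguishes the two vertices.
      have h1 := hk ⟨n - 1, by omega⟩
      have h2 := hk i
      have h3 : ∀ l : Fin n, ¬ (⟨n - 1, by omega⟩ : Fin n) < l := by
        intro l hl
        rw [Fin.lt_def] at hl
        have := l.2
        simp only at hl
        omega
      simp only [a, h3, if_false, hii, if_true, lt_irrefl] at h1 h2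
      omega
    intro i i' h
    rcases lt_trichotomy i i' with h' | h' | h'
    · exact absurd h (key _ _ h')
    · exact h'
    · exact absurd h.symm (key _ _ h')
  refine ⟨Finset.univ.image V, ⟨⟨V ⟨0, hn⟩, Finset.mem_image_of_mem _ (Finset.mem_univ _)⟩,
    fun v => if h : ∃ i, V i = v then ν.latticeOf b (a h.choose) else ν.latticeOf b 0,
    ?_, ?_, ?_⟩, ?_⟩
  · simp only [Finset.forall_mem_image]
    intro i _
    have h : ∃ j, V j = V i := ⟨i, rfl⟩
    rw [dif_pos h]
    exact h.choose_spec
  · simp only [Finset.forall_mem_image]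
    intro i _ j _
    rw [dif_pos ⟨i, rfl⟩, dif_pos ⟨j, rfl⟩]
    generalize Exists.choose _ = i'
    generalize Exists.choose _ = j'
    rw [latticeOf_le_iff, latticeOf_le_iff]
    rcases le_total i' j' with h | h
    · left
      intro l
      by_cases hl : l < i'
      · simp [a, hl, hl.trans_le h]
      · simp only [a, hl, if_false]
        split_ifs <;> omega
    · right
      intro l
      by_cases hl : l < j'
      · simp [a, hl, hl.trans_le h]
      · simp only [a, hl, if_false]
        split_ifs <;> omega
  · simp only [Finset.forall_mem_image]
    intro i _ j _
    rw [dif_pos ⟨i, rfl⟩, dif_pos ⟨j, rfl⟩, uniformizer_smul_eq, zpow_smul_latticeOf,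
      latticeOf_le_iff]
    intro l
    simp only [a]
    split_ifs <;> omega
  · rw [Finset.card_image_of_injective _ hinj, Finset.card_univ, Fintype.card_fin]

theorem building_hasDimension (ν : DiscreteValuation K) (hn : 1 ≤ n) :
    (ν.building n).HasDimension (n - 1) := by
  rw [AbstractSimplicialComplex.HasDimension, Nat.sub_add_cancel hn]
  exact ⟨exists_isSimplex_card ν hn, fun s hs => IsSimplex.card_le hs hn⟩

end DiscreteValuation

namespace DiscreteValuation

variable {K : Type*} [Field K] {ν : DiscreteValuation K} {n : ℕ}

/-! ### Bounds for the Euclidean norm on a simplex -/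

theorem abs_sub_le_two_mul_quotientNorm (u : Fin n → ℝ) (i j : Fin n) :
    |u i - u j| ≤ 2 * quotientNorm u := by
  have key : ∀ i, |u i - (∑ j, u j) / n| ≤ quotientNorm u := by
    intro i
    apply Real.abs_le_sqrt
    exact Finset.single_le_sum (f := fun i => (u i - (∑ j, u j) / n) ^ 2)
      (fun i _ => sq_nonneg _) (Finset.mem_univ i)
  have h1 := abs_le.mp (key i)
  have h2 := abs_le.mp (key j)
  rw [abs_le]
  constructor <;> linarith

theorem quotientNorm_le (hn : 1 ≤ n) (u : Fin n → ℝ) (hu : ∀ i, |u i| ≤ 2) :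
    quotientNorm u ≤ 4 * n := by
  have hn' : (1 : ℝ) ≤ n := by exact_mod_cast hn
  have hmean : |(∑ j, u j) / n| ≤ 2 := by
    rw [abs_div, abs_of_pos (by linarith : (0 : ℝ) < n), div_le_iff₀ (by linarith)]
    calc |∑ j, u j| ≤ ∑ j, |u j| := Finset.abs_sum_le_sum_abs _ _
      _ ≤ ∑ _j : Fin n, (2 : ℝ) := Finset.sum_le_sum fun j _ => hu j
      _ = 2 * n := by simp; ring
  apply Real.sqrt_le_iff.mpr
  refine ⟨by positivity, ?_⟩
  calc ∑ i, (u i - (∑ j, u j) / n) ^ 2 ≤ ∑ _i : Fin n, (16 : ℝ) := by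
        refine Finset.sum_le_sum fun i _ => ?_
        have h1 := abs_le.mp (hu i)
        have h2 := abs_le.mp hmean
        nlinarith
    _ = 16 * n := by simp; ring
    _ ≤ (4 * n) ^ 2 := by nlinarith

namespace Realization

theorem sum_eq_one (x : ν.Realization n) {s : Finset (ν.Vertex n)} (hs : x.1.support ⊆ s) :
    ∑ v ∈ s, x.1 v = 1 := by
  exact (Finsupp.sum_of_support_subset x.1 hs (fun _ t => t) (fun _ _ => rfl)).symm.trans x.2.2.1

theorem exists_isSegment (hn : 1 ≤ n) {x y : ν.Realization n} {s : Finset (ν.Vertex n)}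
    (hs : IsSimplex s) (hx : x.1.support ⊆ s) (hy : y.1.support ⊆ s) :
    ∃ r ≤ (4 * n : ℝ), IsSegment x y r := by
  obtain ⟨b, a, ha, hchain⟩ := hs.exists_coordinates
  refine ⟨_, ?_, s, hs, hx, hy, b, a, fun v hv => ⟨_, ha v hv, rfl⟩, rfl⟩
  apply quotientNorm_le hn
  intro i
  obtain ⟨v₀, hv₀⟩ := hs.1
  have h1 : ∑ v ∈ s, (x.1 v - y.1 v) * (a v i : ℝ) =
      ∑ v ∈ s, (x.1 v - y.1 v) * ((a v i : ℝ) - a v₀ i) := by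
    -- Both sets of barycentric coordinates sum to `1`, so coordinates may be taken relative to
    -- `v₀`, where they are at most `1` in absolute value.
    have h0 : ∑ v ∈ s, (x.1 v - y.1 v) * (a v₀ i : ℝ) = 0 := by
      rw [← Finset.sum_mul, Finset.sum_sub_distrib, sum_eq_one x hx, sum_eq_one y hy]
      simp
    simp only [mul_sub]
    rw [Finset.sum_sub_distrib, h0, sub_zero]
  rw [h1]
  calc |∑ v ∈ s, (x.1 v - y.1 v) * ((a v i : ℝ) - a v₀ i)|
      ≤ ∑ v ∈ s, |(x.1 v - y.1 v) * ((a v i : ℝ) - a v₀ i)| := Finset.abs_sum_le_sum_abs _ _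
    _ ≤ ∑ v ∈ s, (x.1 v + y.1 v) := by
        refine Finset.sum_le_sum fun v hv => ?_
        have h2 : |(a v i : ℝ) - a v₀ i| ≤ 1 := by
          have h3 := hchain.le_add_one v hv v₀ hv₀ i
          have h4 := hchain.le_add_one v₀ hv₀ v hv i
          have h5 : |a v i - a v₀ i| ≤ 1 := abs_le.mpr ⟨by omega, by omega⟩
          exact_mod_cast h5
        have h6 : |x.1 v - y.1 v| ≤ x.1 v + y.1 v := by
          have := x.2.1 v
          have := y.2.1 v
          rw [abs_le]
          constructor <;> linarith
        rw [abs_mul]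
        calc _ ≤ (x.1 v + y.1 v) * 1 :=
              mul_le_mul h6 h2 (abs_nonneg _) ((abs_nonneg _).trans h6)
          _ = _ := mul_one _
    _ = 2 := by
        rw [Finset.sum_add_distrib, sum_eq_one x hx, sum_eq_one y hy]
        norm_num

theorem edist_le_of_hasPath {x y : ν.Realization n} {t : ℝ≥0∞} (h : HasPath x y t) :
    edist x y ≤ t := sInf_le h

theorem edist_le_of_isSegment {x y : ν.Realization n} {r : ℝ} (h : IsSegment x y r) :
    edist x y ≤ ENNReal.ofReal r := by
  have := edist_le_of_hasPath (HasPath.cons h (HasPath.nil y))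
  rwa [add_zero] at this

theorem edist_le_of_support_subset (hn : 1 ≤ n) {x y : ν.Realization n}
    {s : Finset (ν.Vertex n)} (hs : IsSimplex s) (hx : x.1.support ⊆ s) (hy : y.1.support ⊆ s) :
    edist x y ≤ (4 * n : ℕ) := by
  obtain ⟨r, hr, h⟩ := exists_isSegment hn hs hx hy
  refine (edist_le_of_isSegment h).trans ?_
  rw [ENNReal.ofReal_le_iff_le_toReal (ENNReal.natCast_ne_top _), ENNReal.toReal_natCast]
  exact_mod_cast hr

end Realization

/-! ### Levels of vectors with respect to points of the building -/

theorem level_latticeOf {b : Module.Basis (Fin n) K (Fin n → K)} {a : Fin n → ℤ}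
    {e : Fin n → K} {j : Fin n} (hj : b.repr e j ≠ 0)
    (hmin : ∀ i, b.repr e i ≠ 0 → ν.ord (b.repr e j) + a j ≤ ν.ord (b.repr e i) + a i) :
    (ν.latticeOf b a).level e = ν.ord (b.repr e j) + a j := by
  have he : e ≠ 0 := by
    rintro rfl
    simp at hj
  apply Lattice.level_eq_of_forall _ he
  intro k
  rw [zpow_smul_mem_latticeOf_iff]
  constructor
  · intro h
    have := h j hj
    omega
  · intro h i hi
    have := hmin i hi
    omega

/-- One index computes the level at all vertices, so levels are affine on the simplex. Passing from
one vertex to another changes all coordinates in the same direction by `0` or `1`; hence an index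
strictly better at one vertex is at least as good at all others, and a minimiser of the sum over the
vertices works. -/
theorem IsChain.exists_level_eq {s : Finset (ν.Vertex n)}
    {a : ν.Vertex n → Fin n → ℤ}
    (ha : IsChain s a) (b : Module.Basis (Fin n) K (Fin n → K)) {e : Fin n → K} (he : e ≠ 0) :
    ∃ j, ∀ v ∈ s, (ν.latticeOf b (a v)).level e = ν.ord (b.repr e j) + a v j := by
  classical
  have hne : (Finset.univ.filter fun i => b.repr e i ≠ 0).Nonempty := by
    by_contra h
    rw [Finset.not_nonempty_iff_eq_empty, Finset.filter_eq_empty_iff] at h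
    apply he
    apply b.repr.injective
    ext i
    simpa using h (Finset.mem_univ i)
  obtain ⟨j, hj, hmin⟩ := Finset.exists_min_image _
    (fun i => ∑ v ∈ s, (ν.ord (b.repr e i) + a v i)) hne
  simp only [Finset.mem_filter, Finset.mem_univ, true_and] at hj hmin
  refine ⟨j, fun v hv => level_latticeOf hj fun i hi => ?_⟩
  by_contra hcon
  have hlt : ∑ v ∈ s, (ν.ord (b.repr e i) + a v i) < ∑ v ∈ s, (ν.ord (b.repr e j) + a v j) := by
    refine Finset.sum_lt_sum (fun w hw => ?_) ⟨v, hv, by omega⟩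
    have h1 := ha.le_add_one v hv w hw i
    have h2 := ha.le_add_one v hv w hw j
    have h3 := ha.le_add_one w hw v hv i
    have h4 := ha.le_add_one w hw v hv j
    rcases ha.total v hv w hw with h | h
    · have := h i
      have := h j
      omega
    · have := h i
      have := h j
      omega
  exact absurd (hmin i hi) (not_le.mpr hlt)

/-- The difference of the levels of two vectors with respect to a lattice only depends on its
homothety class. -/
def Vertex.level (v : ν.Vertex n) (e e' : Fin n → K) : ℤ :=
  Lattice.level (Quotient.out v) e - Lattice.level (Quotient.out v) e'

theorem Lattice.level_toVertex (L : ν.Lattice n) {e e' : Fin n → K} (he : e ≠ 0) (he' : e' ≠ 0) :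
    L.toVertex.level e e' = L.level e - L.level e' := by
  obtain ⟨k, hk⟩ : ∃ k, L = Lattice.shift (Quotient.out L.toVertex) k :=
    toVertex_eq_iff.mp (Quotient.out_eq L.toVertex)
  conv_rhs => rw [hk, level_shift _ _ he, level_shift _ _ he']
  rw [Vertex.level]
  ring

namespace Realization

/-- The affine extension of `Vertex.level`. -/
def level (x : ν.Realization n) (e e' : Fin n → K) : ℝ :=
  x.1.sum fun v t => t * v.level e e'

theorem level_eq_sum (x : ν.Realization n) {s : Finset (ν.Vertex n)} (hs : x.1.support ⊆ s)
    (e e' : Fin n → K) : x.level e e' = ∑ v ∈ s, x.1 v * v.level e e' :=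
  Finsupp.sum_of_support_subset x.1 hs _ (fun _ _ => by simp)

/-- On the simplex the level difference equals a difference of two apartment coordinates plus a
constant, and the constant cancels between `x` and `y`. -/
theorem abs_level_sub_level_le_of_isSegment {x y : ν.Realization n} {r : ℝ}
    (h : IsSegment x y r) {e e' : Fin n → K} (he : e ≠ 0) (he' : e' ≠ 0) :
    |x.level e e' - y.level e e'| ≤ 2 * r := by
  obtain ⟨s, hs, hx, hy, b, a, ha, rfl⟩ := h
  have ha' : ∀ v ∈ s, (ν.latticeOf b (a v)).toVertex = v := by
    intro v hv
    obtain ⟨L, hL, hL'⟩ := ha v hv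
    refine Eq.trans ?_ hL
    exact congrArg _ (Subtype.ext hL'.symm)
  obtain ⟨k, hk⟩ := IsSimplex.exists_isChain_add hs ha'
  obtain ⟨j, hj⟩ := hk.exists_level_eq b he
  obtain ⟨j', hj'⟩ := hk.exists_level_eq b he'
  have hlev : ∀ v ∈ s, v.level e e' =
      (a v j - a v j') + (ν.ord (b.repr e j) - ν.ord (b.repr e' j')) := by
    intro v hv
    have h1 := hj v hv
    have h2 := hj' v hv
    rw [← latticeOf_shift, Lattice.level_shift _ _ he] at h1
    rw [← latticeOf_shift, Lattice.level_shift _ _ he'] at h2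
    conv_lhs => rw [← ha' v hv]
    rw [Lattice.level_toVertex _ he he']
    omega
  refine le_trans (le_of_eq ?_) (abs_sub_le_two_mul_quotientNorm _ j j')
  congr 1
  rw [level_eq_sum x hx, level_eq_sum y hy, ← Finset.sum_sub_distrib, ← Finset.sum_sub_distrib]
  have h0 : ∑ v ∈ s, (x.1 v - y.1 v) *
      ((ν.ord (b.repr e j) - ν.ord (b.repr e' j') : ℤ) : ℝ) = 0 := by
    rw [← Finset.sum_mul, Finset.sum_sub_distrib, sum_eq_one x hx, sum_eq_one y hy]
    simp
  rw [← sub_eq_zero, ← Finset.sum_sub_distrib]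
  refine Eq.trans ?_ h0
  refine Finset.sum_congr rfl fun v hv => ?_
  rw [hlev v hv]
  push_cast
  ring

theorem ofReal_abs_level_sub_level_le (x y : ν.Realization n) {e e' : Fin n → K} (he : e ≠ 0)
    (he' : e' ≠ 0) : ENNReal.ofReal (|x.level e e' - y.level e e'| / 2) ≤ edist x y := by
  refine le_sInf fun t ht => ?_
  induction ht with
  | nil x => simp
  | @cons x y z r t h p ih =>
    refine le_trans ?_ (add_le_add_right ih _)
    rw [← ENNReal.ofReal_add]
    · apply ENNReal.ofReal_le_ofReal
      have h1 := abs_level_sub_level_le_of_isSegment h he he'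
      have h2 := abs_sub_le (x.level e e') (y.level e e') (z.level e e')
      linarith
    · have h1 := abs_level_sub_level_le_of_isSegment h he he'
      have := abs_nonneg (x.level e e' - y.level e e')
      linarith
    · positivity

theorem level_eq_of_edist_eq_zero {x y : ν.Realization n} (h : edist x y = 0)
    {e e' : Fin n → K} (he : e ≠ 0) (he' : e' ≠ 0) : x.level e e' = y.level e e' := by
  have h1 := ofReal_abs_level_sub_level_le x y he he'
  rw [h, nonpos_iff_eq_zero, ENNReal.ofReal_eq_zero] at h1
  have := abs_nonneg (x.level e e' - y.level e e')
  exact sub_eq_zero.mp (abs_eq_zero.mp (by linarith))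

end Realization

end DiscreteValuation

theorem Finset.exists_forall_ge_of_chain {α : Type*} [PartialOrder α] (S : Finset α)
    (hS : S.Nonempty) (h : ∀ x ∈ S, ∀ y ∈ S, x ≤ y ∨ y ≤ x) : ∃ m ∈ S, ∀ x ∈ S, m ≤ x := by
  obtain ⟨m, hm⟩ := S.exists_minimal hS
  refine ⟨m, hm.1, fun x hx => ?_⟩
  rcases h m hm.1 x hx with h | h
  · exact h
  · exact hm.2 hx h

namespace DiscreteValuation

variable {K : Type*} [Field K] {ν : DiscreteValuation K} {n : ℕ}

/-! ### The distance separates points -/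

theorem Lattice.exists_greatest_shift (hn : 1 ≤ n) (M L : ν.Lattice n) :
    ∃ m : ℤ, ∀ k : ℤ, M.1 ≤ (L.shift k).1 ↔ k ≤ m := by
  obtain ⟨b, rfl⟩ := M.exists_eq_latticeOf
  have : Nonempty (Fin n) := ⟨⟨0, hn⟩⟩
  obtain ⟨i, -, hi⟩ := Finset.exists_min_image Finset.univ (fun i => L.level (b i))
    Finset.univ_nonempty
  refine ⟨L.level (b i), fun k => ⟨fun h => ?_, fun h => Submodule.span_le.mpr ?_⟩⟩
  · have h1 : b i ∈ (ν.latticeOf b fun _ => 0).1 :=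
      Submodule.subset_span ⟨i, by simp⟩
    rw [L.le_level_iff (b.ne_zero i), ← mem_shift_iff]
    exact h h1
  · rintro _ ⟨j, rfl⟩
    simp only [neg_zero, zpow_zero, one_smul]
    rw [SetLike.mem_coe, mem_shift_iff, ← L.le_level_iff (b.ne_zero j)]
    exact h.trans (hi j (Finset.mem_univ j))

theorem Lattice.uniformizer_smul_le_iff {L M : ν.Lattice n} :
    ν.uniformizer • L.1 ≤ M.1 ↔ ∀ e, e ≠ 0 → L.level e ≤ M.level e + 1 := by
  rw [uniformizer_smul_eq, ← shift_val, le_iff_level]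
  refine forall_congr' fun e => forall_congr' fun he => ?_
  rw [level_shift _ _ he]
  omega

/-- The chain of a simplex continues periodically: all homothets of its members are totally ordered.
-/
theorem shift_le_shift_of_chain {L M : ν.Lattice n} (h : L.1 ≤ M.1 ∨ M.1 ≤ L.1)
    (h1 : ν.uniformizer • L.1 ≤ M.1) (h2 : ν.uniformizer • M.1 ≤ L.1) (k l : ℤ) :
    (L.shift k).1 ≤ (M.shift l).1 ∨ (M.shift l).1 ≤ (L.shift k).1 := by
  simp only [Lattice.le_iff_level, Lattice.uniformizer_smul_le_iff] at *
  rcases h with h | h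
  · rcases le_or_gt l k with hkl | hkl
    · left
      intro e he
      have := h e he
      rw [Lattice.level_shift _ _ he, Lattice.level_shift _ _ he]
      omega
    · right
      intro e he
      have := h2 e he
      rw [Lattice.level_shift _ _ he, Lattice.level_shift _ _ he]
      omega
  · rcases le_or_gt k l with hkl | hkl
    · right
      intro e he
      have := h e he
      rw [Lattice.level_shift _ _ he, Lattice.level_shift _ _ he]
      omega
    · left
      intro e he
      have := h1 e he
      rw [Lattice.level_shift _ _ he, Lattice.level_shift _ _ he]
      omega

namespace Realization

/-- The level difference is at least `1` at the class of `M`. At an adjacent vertex the two levels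
move in the same direction by at most `1`, so there it is still nonnegative. -/
theorem le_level (x : ν.Realization n) (M : ν.Lattice n) {e e' : Fin n → K}
    (hv : M.toVertex ∈ x.1.support) (he : e ≠ 0) (heM : e ∈ M.1) (he'M : e' ∉ M.1) :
    x.1 M.toVertex ≤ x.level e e' := by
  classical
  have he' : e' ≠ 0 := by
    rintro rfl
    exact he'M (zero_mem _)
  obtain ⟨hne, rep, h0, h1, h2⟩ := x.2.2.2
  simp only [Lattice.le_iff_level, Lattice.uniformizer_smul_le_iff] at h1 h2
  obtain ⟨k, hk⟩ := Lattice.toVertex_eq_iff.mp (h0 _ hv)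
  rw [level_eq_sum x subset_rfl]
  have hle : ∀ w ∈ x.1.support, (if w = M.toVertex then 1 else 0) ≤ w.level e e' := by
    intro w hw
    rw [M.mem_iff_level he, hk, Lattice.level_shift _ _ he] at heM
    rw [M.mem_iff_level he', hk, Lattice.level_shift _ _ he'] at he'M
    conv_rhs => rw [← h0 w hw]
    rw [Lattice.level_toVertex _ he he']
    split_ifs with hwM
    · rw [hwM]
      omega
    · have := h2 _ hv w hw e he
      have := h2 w hw _ hv e' he'
      rcases h1 w hw _ hv with h | h
      · have := h e he
        have := h e' he'
        omega
      · have := h e he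
        have := h e' he'
        omega
  calc x.1 M.toVertex = ∑ w ∈ x.1.support, x.1 w * (if w = M.toVertex then 1 else 0 : ℝ) := by
        simp only [mul_ite, mul_one, mul_zero]
        rw [Finset.sum_ite_eq', if_pos hv]
    _ ≤ _ := by
        refine Finset.sum_le_sum fun w hw => mul_le_mul_of_nonneg_left ?_ (x.2.1 w)
        have := hle w hw
        split_ifs at this ⊢ <;> exact_mod_cast this

/-- Counterpart of `le_level`: for a suitable pair, the level difference is at most `1` at the class
of `M` and at most `0` at the other vertices. Together they recover barycentric coordinates from
levels, which is why the distance separates points. -/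
theorem exists_level_le (hn : 1 ≤ n) (y : ν.Realization n) (M : ν.Lattice n) :
    ∃ e e' : Fin n → K, e ≠ 0 ∧ e ∈ M.1 ∧ e' ∉ M.1 ∧ y.level e e' ≤ y.1 M.toVertex := by
  classical
  obtain ⟨hne, rep, h0, h1, h2⟩ := y.2.2.2
  have hchain : ∀ k : ν.Vertex n → ℤ,
      ∀ N ∈ y.1.support.image fun v => ((rep v).shift (k v)).1,
      ∀ N' ∈ y.1.support.image fun v => ((rep v).shift (k v)).1, N ≤ N' ∨ N' ≤ N := by
    intro k
    simp only [Finset.forall_mem_image]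
    exact fun v hv w hw =>
      shift_le_shift_of_chain (h1 v hv w hw) (h2 v hv w hw) (h2 w hw v hv) _ _
  choose m hm using fun w => Lattice.exists_greatest_shift hn M (rep w)
  -- None of the homothets with exponent `m w + 1` contains `M`. An element of `M` outside the
  -- largest of them is outside all, which bounds its levels above.
  obtain ⟨N, hN, hmax⟩ := Finset.exists_forall_le_of_chain _ (hne.image _)
    (hchain fun w => m w + 1)
  simp only [Finset.forall_mem_image] at hmax
  obtain ⟨q, hq, rfl⟩ := Finset.mem_image.mp hN
  obtain ⟨e, heM, heq⟩ : ∃ e ∈ M.1, e ∉ ((rep q).shift (m q + 1)).1 := by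
    by_contra! hcon
    have := (hm q (m q + 1)).mp hcon
    omega
  have he : e ≠ 0 := by
    rintro rfl
    exact heq (zero_mem _)
  -- The chosen homothets strictly contain `M`: exponent `m w` does this unless `w` is the class of
  -- `M`, where $\pi^{-1}M$ is needed and costs the extra `1`. A vector of the smallest one outside
  -- `M` lies in all of them.
  have hk : ∀ w, ∃ k : ℤ, w ∈ y.1.support → M.1 ≤ ((rep w).shift k).1 ∧
      ¬ ((rep w).shift k).1 ≤ M.1 ∧ m w ≤ k + if w = M.toVertex then 1 else 0 := by
    intro w
    by_cases hw : w ∈ y.1.support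
    · split_ifs with hwM
      · obtain ⟨k, hk⟩ := Lattice.toVertex_eq_iff.mp ((h0 w hw).trans hwM)
        refine ⟨k - 1, fun _ => ⟨?_, fun hcon => ?_, ?_⟩⟩
        · rw [hk]
          exact zpow_smul_le_zpow_smul _ (by omega)
        · rw [hk, Lattice.le_iff_level] at hcon
          have := hcon e he
          rw [Lattice.level_shift _ _ he, Lattice.level_shift _ _ he] at this
          omega
        · have h3 := (hm w (m w)).mpr le_rfl
          rw [hk, Lattice.le_iff_level] at h3
          have := h3 e he
          rw [Lattice.level_shift _ _ he, Lattice.level_shift _ _ he] at this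
          omega
      · refine ⟨m w, fun _ => ⟨(hm w _).mpr le_rfl, fun hcon => hwM ?_, by omega⟩⟩
        have : M = (rep w).shift (m w) :=
          Subtype.ext (le_antisymm ((hm w _).mpr le_rfl) hcon)
        rw [this, Lattice.toVertex_shift, h0 w hw]
    · exact ⟨0, fun h => absurd h hw⟩
  choose k hk using hk
  obtain ⟨N', hN', hmin⟩ := Finset.exists_forall_ge_of_chain _ (hne.image _) (hchain k)
  simp only [Finset.forall_mem_image] at hmin
  obtain ⟨p, hp, rfl⟩ := Finset.mem_image.mp hN'
  obtain ⟨e', he'p, he'M⟩ := SetLike.not_le_iff_exists.mp (hk p hp).2.1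
  have he' : e' ≠ 0 := by
    rintro rfl
    exact he'M (zero_mem _)
  refine ⟨e, e', he, heM, he'M, ?_⟩
  rw [level_eq_sum y subset_rfl]
  have hle : ∀ w ∈ y.1.support, w.level e e' ≤ if w = M.toVertex then 1 else 0 := by
    intro w hw
    have h3 : ¬ m w + 1 ≤ (rep w).level e := by
      rw [Lattice.le_level_iff _ he, ← Lattice.mem_shift_iff]
      exact fun h => heq (hmax hw h)
    have h4 : k w ≤ (rep w).level e' := by
      rw [Lattice.le_level_iff _ he', ← Lattice.mem_shift_iff]
      exact hmin hw he'p
    have h5 := (hk w hw).2.2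
    conv_lhs => rw [← h0 w hw]
    rw [Lattice.level_toVertex _ he he']
    omega
  calc ∑ w ∈ y.1.support, y.1 w * (w.level e e' : ℝ)
      ≤ ∑ w ∈ y.1.support, y.1 w * (if w = M.toVertex then 1 else 0 : ℝ) := by
        refine Finset.sum_le_sum fun w hw => mul_le_mul_of_nonneg_left ?_ (y.2.1 w)
        have := hle w hw
        split_ifs at this ⊢ <;> exact_mod_cast this
    _ = if M.toVertex ∈ y.1.support then y.1 M.toVertex else 0 := by
        simp only [mul_ite, mul_one, mul_zero]
        rw [Finset.sum_ite_eq']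
    _ ≤ y.1 M.toVertex := by
        split_ifs
        · exact le_rfl
        · exact y.2.1 _

theorem apply_le_of_edist_eq_zero (hn : 1 ≤ n) {x y : ν.Realization n} (h : edist x y = 0)
    (v : ν.Vertex n) : x.1 v ≤ y.1 v := by
  by_cases hv : v ∈ x.1.support
  · have hout : Lattice.toVertex (Quotient.out v) = v := Quotient.out_eq v
    obtain ⟨e, e', he, heM, he'M, hle⟩ := exists_level_le hn y (Quotient.out v)
    have he' : e' ≠ 0 := by
      rintro rfl
      exact he'M (zero_mem _)
    have h1 := le_level x (Quotient.out v) (hout.symm ▸ hv) he heM he'M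
    rw [level_eq_of_edist_eq_zero h he he'] at h1
    have h2 := h1.trans hle
    rwa [hout] at h2
  · rw [Finsupp.notMem_support_iff.mp hv]
    exact y.2.1 v

theorem eq_of_edist_eq_zero (hn : 1 ≤ n) {x y : ν.Realization n} (h : edist x y = 0) : x = y :=
  Subtype.ext (Finsupp.ext fun v => le_antisymm (apply_le_of_edist_eq_zero hn h v)
    (apply_le_of_edist_eq_zero hn (by rwa [edist_comm] at h) v))

end Realization

/-! ### The distance is finite -/

/-- A vertex as a point of the geometric realization. -/
def Vertex.toRealization (v : ν.Vertex n) : ν.Realization n :=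
  ⟨Finsupp.single v 1, fun w => by
      classical
      rw [Finsupp.single_apply]
      split_ifs <;> norm_num,
    by simp, by
      rw [Finsupp.support_single _ one_ne_zero]
      exact (ν.building n).singleton_mem v⟩

theorem Vertex.support_toRealization (v : ν.Vertex n) : v.toRealization.1.support = {v} :=
  Finsupp.support_single _ one_ne_zero

theorem edist_toRealization_le_of_mem_support (hn : 1 ≤ n) (x : ν.Realization n) {v : ν.Vertex n}
    (hv : v ∈ x.1.support) : edist x v.toRealization ≤ (4 * n : ℕ) :=
  Realization.edist_le_of_support_subset hn x.2.2.2 subset_rfl (by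
    rwa [Vertex.support_toRealization, Finset.singleton_subset_iff])

theorem isSimplex_pair [DecidableEq (ν.Vertex n)] {L M : ν.Lattice n} (h : M.1 ≤ L.1)
    (h' : ν.uniformizer • L.1 ≤ M.1) : IsSimplex {L.toVertex, M.toVertex} := by
  by_cases hLM : L.toVertex = M.toVertex
  · rw [hLM, Finset.pair_eq_singleton]
    exact (ν.building n).singleton_mem _
  have hu : ∀ N : ν.Lattice n, ν.uniformizer • N.1 ≤ N.1 := by
    intro N
    rw [Lattice.uniformizer_smul_le_iff]
    intro e he
    omega
  refine ⟨by simp, fun v => if v = L.toVertex then L else M, ?_, ?_, ?_⟩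
  · intro v hv
    rcases Finset.mem_insert.mp hv with rfl | hv
    · simp
    · simp [Finset.mem_singleton.mp hv, Ne.symm hLM]
  · intro v _ w _
    dsimp only
    split_ifs
    · exact Or.inl le_rfl
    · exact Or.inr h
    · exact Or.inl h
    · exact Or.inl le_rfl
  · intro v _ w _
    dsimp only
    split_ifs
    · exact hu _
    · exact h'
    · exact (hu _).trans h
    · exact hu _

/-- The lattice $L'=M+\pi L$ is adjacent or equal to $L$ and satisfies $\pi^NL'\subset M$ when
$\pi^{N+1}L\subset M$; so `N` simplices suffice. -/
theorem edist_toVertex_le (hn : 1 ≤ n) (N : ℕ) (L M : ν.Lattice n) (h : M.1 ≤ L.1)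
    (h' : (L.shift N).1 ≤ M.1) :
    edist L.toVertex.toRealization M.toVertex.toRealization ≤ (N * (4 * n) : ℕ) := by
  classical
  induction N generalizing L with
  | zero =>
    rw [Nat.cast_zero, Lattice.shift_zero] at h'
    rw [Subtype.ext (le_antisymm h h'), edist_self]
    exact bot_le
  | succ N ih =>
    have hL : (M.1 ⊔ (L.shift 1).1).IsLattice K :=
      have := M.2
      have := (L.shift 1).2
      Submodule.IsLattice.sup K _ _
    let L' : ν.Lattice n := ⟨_, hL⟩
    have hu : (L.shift 1).1 ≤ L.1 := by
      rw [Lattice.le_iff_level]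
      intro e he
      rw [Lattice.level_shift _ _ he]
      omega
    have h1 : edist L.toVertex.toRealization L'.toVertex.toRealization ≤ (4 * n : ℕ) := by
      refine Realization.edist_le_of_support_subset hn
        (isSimplex_pair (L := L) (M := L') (sup_le h hu) ?_) ?_ ?_
      · rw [uniformizer_smul_eq]
        exact le_sup_right
      · rw [Vertex.support_toRealization]
        simp
      · rw [Vertex.support_toRealization]
        simp
    have h2 := ih L' le_sup_left (by
      rw [Lattice.shift_val]
      refine (Submodule.smul_sup' _ _ _).le.trans ?_
      refine sup_le ?_ ?_
      · intro x hx
        rw [mem_zpow_smul_iff] at hx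
        have := mem_of_smul_mem (d := 1) (uniformizer_zpow_ne_zero _) one_ne_zero
          (by rw [ord_uniformizer_zpow, ord_one]; omega) hx
        rwa [one_smul] at this
      · refine le_trans ?_ h'
        rw [← Lattice.shift_val, Lattice.shift_shift]
        exact le_of_eq (by push_cast; rfl))
    refine (edist_triangle _ _ _).trans ((add_le_add h1 h2).trans ?_)
    rw [← Nat.cast_add]
    exact Nat.cast_le.mpr (le_of_eq (by ring))

theorem edist_ne_top (hn : 1 ≤ n) (x y : ν.Realization n) : edist x y ≠ ⊤ := by
  obtain ⟨v, hv⟩ := x.2.2.2.1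
  obtain ⟨w, hw⟩ := y.2.2.2.1
  have hvw : edist v.toRealization w.toRealization ≠ ⊤ := by
    induction v using Quotient.inductionOn with | h L => ?_
    induction w using Quotient.inductionOn with | h M => ?_
    obtain ⟨m, hm⟩ := Lattice.exists_greatest_shift hn M L
    obtain ⟨l, hl⟩ := Lattice.exists_greatest_shift hn L M
    have h1 := Lattice.le_shift_iff.mp ((hm m).mpr le_rfl)
    have h2 := Lattice.le_shift_iff.mp ((hl l).mpr le_rfl)
    -- From $M\subset\pi^mL$ and $L\subset\pi^lM$ one gets $\pi^{-m-l}L\subset\pi^{-m}M\subset L$.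
    have := edist_toVertex_le hn (-m - l).toNat L (M.shift (-m)) (by
      rw [Lattice.le_iff_level]
      intro e he
      have := h1 e he
      rw [Lattice.level_shift _ _ he]
      omega) (by
      rw [Lattice.le_iff_level]
      intro e he
      have := h2 e he
      rw [Lattice.level_shift _ _ he, Lattice.level_shift _ _ he]
      have := Int.self_le_toNat (-m - l)
      omega)
    rw [Lattice.toVertex_shift] at this
    exact ne_top_of_le_ne_top (ENNReal.natCast_ne_top _) this
  have h1 := edist_toRealization_le_of_mem_support hn x hv
  have h2 := edist_toRealization_le_of_mem_support hn y hw
  rw [edist_comm] at h2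
  refine ne_top_of_le_ne_top ?_ (edist_triangle4 x v.toRealization w.toRealization y)
  simp only [ne_eq, ENNReal.add_eq_top, not_or]
  exact ⟨⟨ne_top_of_le_ne_top (ENNReal.natCast_ne_top _) h1, hvw⟩,
    ne_top_of_le_ne_top (ENNReal.natCast_ne_top _) h2⟩

theorem isGenuineMetric_realization (ν : DiscreteValuation K) (hn : 1 ≤ n) :
    IsGenuineMetric (ν.Realization n) :=
  fun x y => ⟨edist_ne_top hn x y, Realization.eq_of_edist_eq_zero hn⟩

/-! ### The action is isometric -/

theorem smul_realization_apply (g : Matrix.SpecialLinearGroup (Fin n) K) (x : ν.Realization n)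
    (v : ν.Vertex n) : (g • x).1 (g • v) = x.1 v :=
  Finsupp.mapDomain_apply (MulAction.injective g) x.1 v

theorem support_smul_realization [DecidableEq (ν.Vertex n)]
    (g : Matrix.SpecialLinearGroup (Fin n) K) (x : ν.Realization n) :
    (g • x).1.support = x.1.support.image (g • ·) :=
  Finsupp.mapDomain_support_of_injective (MulAction.injective g) x.1

theorem HasCoordinates.smul (g : Matrix.SpecialLinearGroup (Fin n) K)
    {b : Module.Basis (Fin n) K (Fin n → K)} {v : ν.Vertex n} {a : Fin n → ℤ}
    (h : HasCoordinates b v a) :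
    HasCoordinates (b.map (Matrix.SpecialLinearGroup.toLin' g)) (g • v) a := by
  obtain ⟨L, rfl, hL⟩ := h
  refine ⟨g • L, rfl, ?_⟩
  rw [Lattice.smul_val, hL, Submodule.map_span, ← Set.range_comp]
  congr 2
  funext i
  simp [Matrix.SpecialLinearGroup.toLin'_apply]

theorem IsSegment.smul (g : Matrix.SpecialLinearGroup (Fin n) K) {x y : ν.Realization n} {r : ℝ}
    (h : IsSegment x y r) : IsSegment (g • x) (g • y) r := by
  classical
  obtain ⟨s, hs, hx, hy, b, a, ha, rfl⟩ := h
  refine ⟨s.image (g • ·), isSimplex_image_smul g s hs, ?_, ?_,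
    b.map (Matrix.SpecialLinearGroup.toLin' g), fun v => a (g⁻¹ • v), ?_, ?_⟩
  · rw [support_smul_realization]
    exact Finset.image_subset_image hx
  · rw [support_smul_realization]
    exact Finset.image_subset_image hy
  · simp only [Finset.forall_mem_image, inv_smul_smul]
    exact fun v hv => (ha v hv).smul g
  · congr 1
    funext i
    rw [Finset.sum_image fun v _ w _ h => MulAction.injective g h]
    simp only [inv_smul_smul, smul_realization_apply]

theorem HasPath.smul (g : Matrix.SpecialLinearGroup (Fin n) K) {x y : ν.Realization n}
    {t : ℝ≥0∞} (h : HasPath x y t) : HasPath (g • x) (g • y) t := by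
  induction h with
  | nil x => exact .nil _
  | cons h _ ih => exact .cons (h.smul g) ih

theorem isometry_smul (g : Matrix.SpecialLinearGroup (Fin n) K) :
    Isometry fun x : ν.Realization n => g • x := by
  have key : ∀ (g : Matrix.SpecialLinearGroup (Fin n) K) (x y : ν.Realization n),
      edist (g • x) (g • y) ≤ edist x y := fun g x y =>
    le_sInf fun t ht => sInf_le (HasPath.smul g ht)
  intro x y
  refine le_antisymm (key g x y) ?_
  have := key g⁻¹ (g • x) (g • y)
  rwa [inv_smul_smul, inv_smul_smul] at this

end DiscreteValuation

namespace DiscreteValuation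

variable {K : Type*} [Field K] {ν : DiscreteValuation K} {n : ℕ}

/-! ### The retraction from infinity -/

namespace Lattice

/-- The ultrametric inequality. The bounds are only required of nonzero summands, because the level
of `0` is meaningless. -/
theorem le_level_add (L : ν.Lattice n) {e e' : Fin n → K} {k : ℤ} (h : e + e' ≠ 0)
    (he : e ≠ 0 → k ≤ L.level e) (he' : e' ≠ 0 → k ≤ L.level e') : k ≤ L.level (e + e') := by
  rw [L.le_level_iff h, smul_add]
  have key : ∀ x : Fin n → K, (x ≠ 0 → k ≤ L.level x) → ν.uniformizer ^ (-k) • x ∈ L.1 := by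
    intro x hx
    by_cases h0 : x = 0
    · rw [h0, smul_zero]
      exact zero_mem _
    · exact (L.le_level_iff h0).mp (hx h0)
  exact L.1.add_mem (key e he) (key e' he')

variable (K) in
/-- The vectors whose last nonzero coordinate is the `i`-th one, and equal to `1`. -/
def monicVectors (i : Fin n) : Set (Fin n → K) := {w | w i = 1 ∧ ∀ j, i < j → w j = 0}

theorem ne_zero_of_mem_monicVectors {i : Fin n} {w : Fin n → K} (hw : w ∈ monicVectors K i) :
    w ≠ 0 := by
  rintro rfl
  exact zero_ne_one hw.1

/-- The `i`-th coordinate of the retraction of a lattice onto the standard apartment, centred at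
the standard flag. -/
def flagLevel (L : ν.Lattice n) (i : Fin n) : ℤ := sSup (L.level '' monicVectors K i)

/-- In the standard lattice the coordinate `1` bounds the level by `0`; comparison with that lattice
transfers the bound. -/
theorem bddAbove_level_monicVectors (L : ν.Lattice n) (i : Fin n) :
    BddAbove (L.level '' monicVectors K i) := by
  obtain ⟨m, hm⟩ := exists_greatest_shift (by have := i.2; omega) L
    (ν.latticeOf (Pi.basisFun K (Fin n)) fun _ => 0)
  have h := le_shift_iff.mp ((hm m).mpr le_rfl)
  refine ⟨-m, ?_⟩
  rintro _ ⟨w, hw, rfl⟩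
  have h1 := h w (ne_zero_of_mem_monicVectors hw)
  have h2 := (le_level_iff _ (ne_zero_of_mem_monicVectors hw)).mp h1
  rw [zpow_smul_mem_latticeOf_iff] at h2
  have h3 := h2 i
  simp only [Pi.basisFun_repr, hw.1, ord_one] at h3
  have := h3 one_ne_zero
  omega

theorem level_le_flagLevel (L : ν.Lattice n) {i : Fin n} {w : Fin n → K}
    (hw : w ∈ monicVectors K i) : L.level w ≤ L.flagLevel i :=
  le_csSup (L.bddAbove_level_monicVectors i) ⟨w, hw, rfl⟩

theorem exists_level_eq_flagLevel (L : ν.Lattice n) (i : Fin n) :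
    ∃ w ∈ monicVectors K i, L.level w = L.flagLevel i := by
  classical
  have hne : (L.level '' monicVectors K i).Nonempty :=
    ⟨_, Pi.single i 1, ⟨by simp, fun j hj => by simp [hj.ne']⟩, rfl⟩
  exact Int.csSup_mem hne (L.bddAbove_level_monicVectors i)

/-- Two lattices are `N`-close if the levels of each nonzero vector differ by at most `N`. -/
def Close (N : ℕ) (L M : ν.Lattice n) : Prop := ∀ e, e ≠ 0 → |L.level e - M.level e| ≤ N

theorem Close.symm {N : ℕ} {L M : ν.Lattice n} (h : Close N L M) : Close N M L :=
  fun e he => abs_sub_comm (L.level e) (M.level e) ▸ h e he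

theorem Close.abs_flagLevel_le {N : ℕ} {L M : ν.Lattice n} (h : Close N L M) (i : Fin n) :
    |L.flagLevel i - M.flagLevel i| ≤ N := by
  have key : ∀ {L M : ν.Lattice n}, Close N L M → L.flagLevel i - M.flagLevel i ≤ N := by
    intro L M h
    obtain ⟨w, hw, hwL⟩ := L.exists_level_eq_flagLevel i
    have h1 := M.level_le_flagLevel hw
    have h2 := (abs_le.mp (h w (ne_zero_of_mem_monicVectors hw))).2
    omega
  have h1 := key h
  have h2 := key h.symm
  exact abs_le.mpr ⟨by omega, by omega⟩

/-- The lattices are `N`-close and are retracted to the same box of side `R` in the standard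
apartment. -/
def Step (N R : ℕ) (L M : ν.Lattice n) : Prop :=
  Close N L M ∧ ∀ i, L.flagLevel i / R = M.flagLevel i / R

theorem Step.symm {N R : ℕ} {L M : ν.Lattice n} (h : Step N R L M) : Step N R M L :=
  ⟨h.1.symm, fun i => (h.2 i).symm⟩

theorem reflTransGen_step_symm {N R : ℕ} {L M : ν.Lattice n}
    (h : Relation.ReflTransGen (Step N R) L M) : Relation.ReflTransGen (Step N R) M L := by
  induction h with
  | refl => exact .refl
  | tail _ h ih => exact .head h.symm ih

theorem flagLevel_div_eq {N R : ℕ} {L M : ν.Lattice n}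
    (h : Relation.ReflTransGen (Step N R) L M) (i : Fin n) :
    L.flagLevel i / R = M.flagLevel i / R := by
  induction h with
  | refl => rfl
  | tail _ h ih => rw [ih, h.2 i]

/-- The bound does not depend on the length of the chain. Optimal monic vectors of consecutive
lattices differ by a vector supported below `i`, whose level at the start `L` is controlled by `hC`;
the ultrametric inequality takes a minimum and never adds errors. -/
theorem level_monic_ge_of_chain {N R C : ℕ} (hR : 0 < R) {i : Fin n}
    (hC : ∀ {L M : ν.Lattice n}, Relation.ReflTransGen (Step N R) L M →
      ∀ e, e ≠ 0 → (∀ j, i ≤ j → e j = 0) → M.level e - C ≤ L.level e)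
    {L M : ν.Lattice n} (h : Relation.ReflTransGen (Step N R) L M) :
    ∀ w ∈ monicVectors K i, M.level w = M.flagLevel i →
      R * (L.flagLevel i / R) - (N + C) ≤ L.level w := by
  have hdiff : ∀ w ∈ monicVectors K i, ∀ w' ∈ monicVectors K i, ∀ j, i ≤ j →
      (w - w') j = 0 := by
    intro w hw w' hw' j hj
    rw [Pi.sub_apply]
    rcases hj.eq_or_lt with rfl | hj
    · rw [hw.1, hw'.1, sub_self]
    · rw [hw.2 j hj, hw'.2 j hj, sub_self]
  have hlow : ∀ M : ν.Lattice n, R * (M.flagLevel i / R) ≤ M.flagLevel i := fun M =>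
    Int.mul_ediv_self_le (by omega)
  induction h with
  | refl =>
    intro w hw hwM
    have := hlow L
    rw [hwM]
    omega
  | @tail M M' hLM hMM' ih =>
    intro w' hw' hwM'
    obtain ⟨w, hw, hwM⟩ := M.exists_level_eq_flagLevel i
    have h1 := ih w hw hwM
    have hbox := flagLevel_div_eq hLM i
    have hbox' := hMM'.2 i
    have hw'0 := ne_zero_of_mem_monicVectors hw'
    have hsplit : w' = w + (w' - w) := by abel
    rw [hsplit]
    refine L.le_level_add (by rwa [← hsplit]) (fun _ => h1) fun hne => ?_
    have h2 := hC hLM _ hne (hdiff w' hw' w hw)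
    have h3 : R * (L.flagLevel i / R) - N ≤ M.level (w' - w) := by
      have hneg : -w ≠ 0 := neg_ne_zero.mpr (ne_zero_of_mem_monicVectors hw)
      have hlevneg : M.level (-w) = M.level w := by
        rw [← neg_one_smul K w, M.level_smul (neg_ne_zero.mpr one_ne_zero)
          (ne_zero_of_mem_monicVectors hw)]
        simp [ord]
      rw [sub_eq_add_neg w' w] at hne ⊢
      refine M.le_level_add hne (fun _ => ?_) (fun _ => ?_)
      · have h4 := (abs_le.mp (hMM'.1 w' hw'0)).1
        have h5 := hlow M'
        rw [hbox, hbox']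
        omega
      · rw [hlevneg, hwM, hbox]
        have h5 := hlow M
        omega
    omega

/-- Induction on the number `m` of leading coordinates allowed to be nonzero. A one-sided estimate
is enough, since chains can be reversed. -/
theorem exists_close_of_chain (ν : DiscreteValuation K) (n N R : ℕ) (hR : 0 < R) :
    ∃ C : ℕ, ∀ {L M : ν.Lattice n},
      Relation.ReflTransGen (Step N R) L M → Close C L M := by
  have key : ∀ m : ℕ, m ≤ n → ∃ C : ℕ,
      ∀ {L M : ν.Lattice n},
      Relation.ReflTransGen (Step N R) L M → ∀ e, e ≠ 0 → (∀ j : Fin n, m ≤ j → e j = 0) →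
        M.level e - C ≤ L.level e := by
    intro m
    induction m with
    | zero =>
      intro _
      refine ⟨0, fun {L M} h e he he0 => absurd (funext fun j => he0 j ?_) he⟩
      omega
    | succ m ih =>
      intro hm
      obtain ⟨C, hC⟩ := ih (by omega)
      refine ⟨R + N + C, fun {L M} h e he he0 => ?_⟩
      let i : Fin n := ⟨m, hm⟩
      by_cases hi : e i = 0
      · have := hC h e he (fun j hj => by
          rcases hj.eq_or_lt with hj | hj
          · rw [← hi]
            congr 1
            exact Fin.ext hj.symm
          · exact he0 j hj)
        push_cast
        omega
      obtain ⟨w, hw, hwM⟩ := M.exists_level_eq_flagLevel i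
      have hw0 := ne_zero_of_mem_monicVectors hw
      have h1 := level_monic_ge_of_chain (ν := ν) hR (i := i) (C := C)
        (fun {L M} h e he he0 => hC h e he he0) h w hw hwM
      have h2 : M.level e ≤ ν.ord (e i) + M.flagLevel i := by
        have hm' : (e i)⁻¹ • e ∈ monicVectors K i := by
          refine ⟨by simp [hi], fun j hj => ?_⟩
          rw [Pi.smul_apply, he0 j (by rw [Fin.lt_def] at hj; exact hj), smul_zero]
        have h3 := M.level_le_flagLevel hm'
        rw [M.level_smul (inv_ne_zero hi) he, ord_inv] at h3
        omega
      -- Both summands have `M`-level at least that of `e`, as `w` is optimal. Passing to `L` costs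
      -- `R + N + C` for the first, `R` being the box width, and `C` for the second, which has one
      -- coordinate less.
      have hsplit : e = e i • w + (e - e i • w) := by abel
      have hsm : M.level (e i • w) = ν.ord (e i) + M.flagLevel i := by
        rw [M.level_smul hi hw0, hwM]
      conv_rhs => rw [hsplit]
      refine L.le_level_add (by rwa [← hsplit]) (fun _ => ?_) (fun hne => ?_)
      · rw [L.level_smul hi hw0]
        have hbox := flagLevel_div_eq h i
        have hup := Int.lt_ediv_add_one_mul_self (M.flagLevel i) (b := R) (by omega)
        rw [hbox] at h1
        have : (M.flagLevel i / R + 1) * R = R * (M.flagLevel i / R) + R := by ring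
        push_cast
        omega
      · have h4 := hC h _ hne (fun j hj => by
          rw [Pi.sub_apply, Pi.smul_apply]
          rcases hj.eq_or_lt with hj | hj
          · have : j = i := Fin.ext hj.symm
            rw [this, hw.1]
            simp
          · rw [he0 j hj, hw.2 j hj]
            simp)
        have h5 : M.level e ≤ M.level (e - e i • w) := by
          have hneg : -(e i • w) = (-e i) • w := (neg_smul _ _).symm
          rw [sub_eq_add_neg] at hne ⊢
          refine M.le_level_add hne (fun _ => le_rfl) (fun _ => ?_)
          rw [hneg, M.level_smul (neg_ne_zero.mpr hi) hw0, hwM]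
          have : ν.ord (-e i) = ν.ord (e i) := by simp [ord]
          rw [this]
          exact h2
        push_cast
        omega
  obtain ⟨C, hC⟩ := key n le_rfl
  refine ⟨C, fun {L M} h e he => ?_⟩
  have h1 := hC h e he (fun j hj => absurd j.2 (by omega))
  have h2 := hC (reflTransGen_step_symm h) e he (fun j hj => absurd j.2 (by omega))
  exact abs_le.mpr ⟨by omega, by omega⟩

end Lattice

/-! ### Finite asymptotic dimension -/

/-- The representative of a homothety class with respect to which `e₀` has level `0`. -/
def Vertex.normalize (e₀ : Fin n → K) (v : ν.Vertex n) : ν.Lattice n :=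
  Lattice.shift (Quotient.out v) (Lattice.level (Quotient.out v) e₀)

theorem Vertex.toVertex_normalize (e₀ : Fin n → K) (v : ν.Vertex n) :
    (v.normalize e₀).toVertex = v := by
  rw [normalize, Lattice.toVertex_shift]
  exact Quotient.out_eq v

theorem Vertex.level_normalize (e₀ : Fin n → K) (v : ν.Vertex n) {e : Fin n → K} (he : e ≠ 0) :
    (v.normalize e₀).level e = v.level e e₀ := by
  rw [normalize, Lattice.level_shift _ _ he, level]

theorem Vertex.level_toRealization (v : ν.Vertex n) (e e' : Fin n → K) :
    v.toRealization.level e e' = v.level e e' := by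
  refine (Finsupp.sum_single_index ?_).trans (one_mul _)
  simp

/-- With `e₀` normalised to level `0`, levels are level differences, which are Lipschitz with
constant `2`. This makes a retraction of lattices usable on homothety classes. -/
theorem Vertex.close_normalize {e₀ : Fin n → K} (he₀ : e₀ ≠ 0) {v w : ν.Vertex n} {N : ℕ}
    (h : edist v.toRealization w.toRealization ≤ N) :
    Lattice.Close (2 * N) (v.normalize e₀) (w.normalize e₀) := by
  intro e he
  rw [level_normalize _ _ he, level_normalize _ _ he]
  have h1 := (Realization.ofReal_abs_level_sub_level_le _ _ he he₀).trans h
  rw [level_toRealization, level_toRealization,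
    ENNReal.ofReal_le_iff_le_toReal (ENNReal.natCast_ne_top _), ENNReal.toReal_natCast,
    div_le_iff₀ two_pos] at h1
  have h2 : ((|v.level e e₀ - w.level e e₀| : ℤ) : ℝ) ≤ ((2 * N : ℕ) : ℤ) := by
    push_cast
    linarith
  exact_mod_cast h2

theorem Vertex.edist_le_of_close (hn : 1 ≤ n) {e₀ : Fin n → K} {v w : ν.Vertex n} {N : ℕ}
    (h : Lattice.Close N (v.normalize e₀) (w.normalize e₀)) :
    edist v.toRealization w.toRealization ≤ (2 * N * (4 * n) : ℕ) := by
  have := edist_toVertex_le hn (2 * N) (v.normalize e₀) ((w.normalize e₀).shift N) (by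
    rw [Lattice.le_iff_level]
    intro e he
    have := abs_le.mp (h e he)
    rw [Lattice.level_shift _ _ he]
    omega) (by
    rw [Lattice.le_iff_level]
    intro e he
    have := abs_le.mp (h e he)
    rw [Lattice.level_shift _ _ he, Lattice.level_shift _ _ he]
    push_cast
    omega)
  rwa [Lattice.toVertex_shift, toVertex_normalize, toVertex_normalize] at this

theorem asdimLE_realization (ν : DiscreteValuation K) (hn : 1 ≤ n) :
    AsdimLE (ν.Realization n) (2 ^ n) := by
  classical
  intro d _
  let e₀ : Fin n → K := Pi.single ⟨0, hn⟩ 1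
  have he₀ : e₀ ≠ 0 := by simp [e₀]
  choose p hp using fun x : ν.Realization n => x.2.2.2.1
  let E : ν.Realization n → ν.Lattice n := fun x => (p x).normalize e₀
  have hE : ∀ (x y : ν.Realization n) (D : ℕ), edist x y ≤ D →
      Lattice.Close (2 * (4 * n + D + 4 * n)) (E x) (E y) := by
    intro x y D h
    apply Vertex.close_normalize he₀
    refine (edist_triangle4 _ x y _).trans ?_
    push_cast
    refine add_le_add (add_le_add ?_ h) ?_
    · rw [edist_comm]
      exact_mod_cast edist_toRealization_le_of_mem_support hn x (hp x)
    · exact_mod_cast edist_toRealization_le_of_mem_support hn y (hp y)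
  obtain ⟨D, hD⟩ := exists_nat_ge d
  -- Two points of a ball are at distance at most `D + D`, and each is within `4 * n` of its chosen
  -- vertex. Boxes of side `2 * N + 1` ensure that an interval of radius `N` meets at most two of
  -- them.
  let N := 2 * (4 * n + (D + D) + 4 * n)
  let R := 2 * N + 1
  let r : ν.Realization n → ν.Realization n → Prop := fun x y =>
    Relation.ReflTransGen (Lattice.Step N R) (E x) (E y)
  have hsymm : ∀ {x y}, r x y → r y x := Lattice.reflTransGen_step_symm
  have htrans : ∀ {x y z}, r x y → r y z → r x z := Relation.ReflTransGen.trans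
  obtain ⟨C, hC⟩ := Lattice.exists_close_of_chain ν n N R (by omega)
  have hdD : (d : ℝ≥0∞) ≤ D := by exact_mod_cast hD
  refine ⟨Set.range fun x => {y | r x y}, ?_, ⟨(4 * n + 2 * C * (4 * n) + 4 * n : ℕ), ?_⟩, ?_⟩
  · exact Set.eq_univ_of_forall fun x => ⟨_, ⟨x, rfl⟩, Relation.ReflTransGen.refl⟩
  · rintro _ ⟨z, rfl⟩ x hx y hy
    have h := Vertex.edist_le_of_close hn (hC (htrans (hsymm hx) hy))
    refine (edist_triangle4 x (p x).toRealization (p y).toRealization y).trans ?_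
    push_cast at h ⊢
    refine add_le_add (add_le_add ?_ h) ?_
    · exact_mod_cast edist_toRealization_le_of_mem_support hn x (hp x)
    · rw [edist_comm]
      exact_mod_cast edist_toRealization_le_of_mem_support hn y (hp y)
  · intro x
    let T : Set (Set (ν.Realization n)) :=
      {u ∈ Set.range fun x => {y | r x y} | ∃ y ∈ u, edist y x ≤ d}
    have : Nonempty (ν.Realization n) := ⟨x⟩
    choose! y hyu hyx using fun (u : Set (ν.Realization n)) (hu : u ∈ T) => hu.2
    let q : Fin n → ℤ := fun i => ((E x).flagLevel i - N) / R
    let P : Finset (Fin n → ℤ) := Fintype.piFinset fun i => {q i, q i + 1}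
    have hP : P.card ≤ 2 ^ n := by
      rw [Fintype.card_piFinset]
      refine (Finset.prod_le_prod' fun i _ => Finset.card_le_two).trans ?_
      simp
    have hmaps : Set.MapsTo (fun u i => (E (y u)).flagLevel i / (R : ℤ)) T P := by
      intro u hu
      rw [Finset.mem_coe, Fintype.mem_piFinset]
      intro i
      rw [Finset.mem_insert, Finset.mem_singleton]
      have h1 := abs_le.mp ((hE (y u) x (D + D) ((hyx u hu).trans (hdD.trans
        (Nat.cast_le.mpr (Nat.le_add_right D D))))).abs_flagLevel_le i)
      have h2 : q i ≤ (E (y u)).flagLevel i / R := Int.ediv_le_ediv (by omega) (by omega)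
      have h3 : (E (y u)).flagLevel i / R ≤ ((E x).flagLevel i - N + 1 * R) / R :=
        Int.ediv_le_ediv (by omega) (by omega)
      rw [Int.add_mul_ediv_right _ _ (by omega : (R : ℤ) ≠ 0)] at h3
      change (E (y u)).flagLevel i / (R : ℤ) = ((E x).flagLevel i - N) / R ∨
        (E (y u)).flagLevel i / (R : ℤ) = ((E x).flagLevel i - N) / R + 1
      change ((E x).flagLevel i - N) / R ≤ _ at h2
      omega
    -- Two points of the ball lying over the same box are joined by a single step, so their classes
    -- coincide.
    have hinj : Set.InjOn (fun u i => (E (y u)).flagLevel i / (R : ℤ)) T := by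
      intro u hu u' hu' h
      have hyy : edist (y u) (y u') ≤ (D + D : ℕ) := by
        refine (edist_triangle _ x _).trans ?_
        rw [Nat.cast_add]
        refine add_le_add ((hyx u hu).trans hdD) ?_
        rw [edist_comm]
        exact (hyx u' hu').trans hdD
      have hr : r (y u) (y u') :=
        Relation.ReflTransGen.single ⟨hE _ _ _ hyy, fun i => congrFun h i⟩
      have h1 := hyu u hu
      have h2 := hyu u' hu'
      obtain ⟨⟨z, rfl⟩, -⟩ := hu
      obtain ⟨⟨z', rfl⟩, -⟩ := hu'
      have hzz : r z z' := htrans (htrans h1 hr) (hsymm h2)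
      ext w
      exact ⟨fun hw => htrans (hsymm hzz) hw, fun hw => htrans hzz hw⟩
    calc T.encard ≤ (P : Set (Fin n → ℤ)).encard := Set.encard_le_encard_of_injOn hmaps hinj
      _ = (P.card : ℕ∞) := Set.encard_coe_eq_coe_finsetCard P
      _ ≤ (2 ^ n : ℕ) := Nat.cast_le.mpr hP
      _ ≤ (2 ^ n : ℕ) + 1 := le_self_add

end DiscreteValuation

namespace DiscreteValuation

variable {K : Type*} [Field K] {ν : DiscreteValuation K} {n : ℕ}

/-! ### Characteristic polynomials of elements with a fixed point -/

/-- In a basis of the stable lattice the matrix has integral entries. -/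
theorem charpoly_coeff_mem_integers (g : Matrix (Fin n) (Fin n) K) (L : ν.Lattice n)
    (h : ∀ x ∈ L.1, Matrix.toLin' g x ∈ L.1) (k : ℕ) : g.charpoly.coeff k ∈ ν.integers := by
  obtain ⟨b, rfl⟩ := L.exists_eq_latticeOf
  have hentry : ∀ i j, LinearMap.toMatrix b b (Matrix.toLin' g) i j ∈ ν.integers := by
    intro i j
    rw [LinearMap.toMatrix_apply]
    have hb : b j ∈ (ν.latticeOf b fun _ => 0).1 := Submodule.subset_span ⟨j, by simp⟩
    have := mem_latticeOf_iff.mp (h _ hb) i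
    by_cases h0 : b.repr (Matrix.toLin' g (b j)) i = 0
    · rw [h0]
      exact zero_mem _
    · rw [mem_integers_iff h0]
      have := this h0
      omega
  let m : Matrix (Fin n) (Fin n) ν.integers := fun i j => ⟨_, hentry i j⟩
  have hm : m.map (algebraMap ν.integers K) = LinearMap.toMatrix b b (Matrix.toLin' g) := rfl
  have hchar : g.charpoly = m.charpoly.map (algebraMap ν.integers K) := by
    rw [← Matrix.charpoly_map, hm, LinearMap.charpoly_toMatrix,
      ← LinearMap.charpoly_toMatrix (Matrix.toLin' g) (Pi.basisFun K (Fin n)),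
      ← Matrix.toLin_eq_toLin', LinearMap.toMatrix_toLin]
  rw [hchar, Polynomial.coeff_map]
  exact (m.charpoly.coeff k).2

theorem det_mem_integers (g : Matrix (Fin n) (Fin n) K) (L : ν.Lattice n)
    (h : ∀ x ∈ L.1, Matrix.toLin' g x ∈ L.1) : g.det ∈ ν.integers := by
  rw [Matrix.det_eq_sign_charpoly_coeff]
  exact mul_mem (pow_mem (neg_mem (one_mem _)) _) (charpoly_coeff_mem_integers g L h 0)

theorem toLin'_mem_smul (g : Matrix.SpecialLinearGroup (Fin n) K) (L : ν.Lattice n)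
    {x : Fin n → K} (hx : x ∈ L.1) :
    Matrix.toLin' (g : Matrix (Fin n) (Fin n) K) x ∈ (g • L).1 :=
  Submodule.mem_map_of_mem hx

/-- The matrix $\pi^{-k}g$ preserves the lattice, so its determinant $\pi^{-kn}$ is integral.
Applied to `g` and to `g⁻¹`, this shows that fixing a vertex means fixing the lattice. -/
theorem shift_exponent_nonpos (hn : 1 ≤ n) {g : Matrix.SpecialLinearGroup (Fin n) K}
    {L : ν.Lattice n} {k : ℤ} (h : g • L = L.shift k) : k ≤ 0 := by
  have h1 := det_mem_integers (ν.uniformizer ^ (-k) • (g : Matrix (Fin n) (Fin n) K)) L (by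
    intro x hx
    have := toLin'_mem_smul g L hx
    rw [h, Lattice.mem_shift_iff] at this
    rwa [map_smul, LinearMap.smul_apply])
  rw [Matrix.det_smul, g.det_coe, mul_one, Fintype.card_fin, ← zpow_natCast, ← zpow_mul,
    mem_integers_iff (uniformizer_zpow_ne_zero _), ord_uniformizer_zpow] at h1
  have hn' : (1 : ℤ) ≤ n := by exact_mod_cast hn
  nlinarith

theorem smul_shift (g : Matrix.SpecialLinearGroup (Fin n) K) (L : ν.Lattice n) (k : ℤ) :
    g • L.shift k = (g • L).shift k :=
  Subtype.ext (Lattice.map_smul_comm g _ L.1)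

theorem smul_lattice_eq_of_smul_vertex_eq (hn : 1 ≤ n)
    {g : Matrix.SpecialLinearGroup (Fin n) K} {L : ν.Lattice n}
    (h : g • L.toVertex = L.toVertex) : g • L = L := by
  rw [smul_toVertex, eq_comm, Lattice.toVertex_eq_iff] at h
  obtain ⟨k, hk⟩ := h
  have h1 := shift_exponent_nonpos hn hk
  have h2 : g⁻¹ • L = L.shift (-k) := by
    rw [inv_smul_eq_iff, smul_shift, hk, Lattice.shift_shift, neg_add_cancel, Lattice.shift_zero]
  have h3 := shift_exponent_nonpos hn h2
  have : k = 0 := by omega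
  rw [hk, this, Lattice.shift_zero]

/-- The orbit of a vertex of the carrier simplex stays in that finite set, so two powers agree on
it. -/
theorem exists_pow_smul_eq {g : Matrix.SpecialLinearGroup (Fin n) K} {x : ν.Realization n}
    (h : g • x = x) : ∃ (v : ν.Vertex n) (m : ℕ), 0 < m ∧ g ^ m • v = v := by
  classical
  obtain ⟨v, hv⟩ := x.2.2.2.1
  have hpow : ∀ k : ℕ, g ^ k • v ∈ x.1.support := by
    intro k
    induction k with
    | zero => simpa using hv
    | succ k ih =>
      rw [pow_succ', mul_smul, ← h, support_smul_realization]
      exact Finset.mem_image_of_mem _ ih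
  obtain ⟨k, l, hne, hkl⟩ := Finite.exists_ne_map_eq_of_infinite
    (fun k : ℕ => (⟨g ^ k • v, hpow k⟩ : x.1.support))
  simp only [Subtype.mk.injEq] at hkl
  wlog hlt : k < l generalizing k l
  · exact this l k hne.symm hkl.symm (by omega)
  refine ⟨v, l - k, by omega, ?_⟩
  have : g ^ l = g ^ k * g ^ (l - k) := by rw [← pow_add]; congr 1; omega
  rw [this, mul_smul] at hkl
  exact (MulAction.injective _ hkl).symm

theorem charpoly_coeff_mem_integers_of_smul_eq (hn : 1 ≤ n)
    {g : Matrix.SpecialLinearGroup (Fin n) K} {x : ν.Realization n} (h : g • x = x) (k : ℕ) :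
    (g : Matrix (Fin n) (Fin n) K).charpoly.coeff k ∈ ν.integers := by
  obtain ⟨v, m, hm, hv⟩ := exists_pow_smul_eq h
  induction v using Quotient.inductionOn with | h L => ?_
  have hL : g ^ m • L = L := smul_lattice_eq_of_smul_vertex_eq hn hv
  -- Since `g ^ m` fixes `L`, the sum of the finite orbit of `L` is stable under `g` itself.
  have hlat : (⨆ i ∈ Finset.range m, (g ^ i • L).1).IsLattice K := by
    have := L.2
    refine Submodule.IsLattice.of_le_of_isLattice_of_fg K (M := L.1) ?_ ?_
    · refine le_trans (le_of_eq ?_)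
        (le_biSup (fun i => (g ^ i • L).1) (Finset.mem_range.mpr hm))
      rw [pow_zero, one_smul]
    · exact Submodule.fg_biSup _ _ fun i _ => (g ^ i • L).2.fg
  refine charpoly_coeff_mem_integers _ (⟨_, hlat⟩ : ν.Lattice n) ?_ k
  change (⨆ i ∈ Finset.range m, (g ^ i • L).1) ≤
    Submodule.comap ((Matrix.toLin' (g : Matrix (Fin n) (Fin n) K)).restrictScalars
      ν.integers) (⨆ i ∈ Finset.range m, (g ^ i • L).1)
  refine iSup₂_le fun i hi y hy => ?_
  have h1 : Matrix.toLin' (g : Matrix (Fin n) (Fin n) K) y ∈ (g ^ (i + 1) • L).1 := by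
    rw [pow_succ', mul_smul]
    exact toLin'_mem_smul g _ hy
  rw [Submodule.mem_comap]
  by_cases him : i + 1 = m
  · rw [him, hL] at h1
    have h2 := le_biSup (fun i => (g ^ i • L).1) (Finset.mem_range.mpr hm)
    simp only [pow_zero, one_smul] at h2
    exact h2 h1
  · have h2 := le_biSup (fun i => (g ^ i • L).1)
      (Finset.mem_range.mpr (by have := Finset.mem_range.mp hi; omega : i + 1 < m))
    exact h2 h1

end DiscreteValuation

namespace DiscreteValuation

/-! ### Constructing discrete valuations -/

/-- A function on a domain with the properties of an additive valuation extends to a discrete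
valuation of the field of fractions. -/
theorem exists_of_ord {P F : Type*} [CommRing P] [IsDomain P] [Field F] [Algebra P F]
    [IsFractionRing P F] (δ : P → ℤ) (hone : δ 1 = 0)
    (hmul : ∀ a b, a ≠ 0 → b ≠ 0 → δ (a * b) = δ a + δ b)
    (hadd : ∀ a b, a ≠ 0 → b ≠ 0 → a + b ≠ 0 → min (δ a) (δ b) ≤ δ (a + b))
    {t : P} (ht : t ≠ 0) (hδt : δ t = 1 ∨ δ t = -1) :
    ∃ ν : DiscreteValuation F, ∀ a, a ≠ 0 → ν.ord (algebraMap P F a) = δ a := by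
  classical
  let w : Valuation P ℤᵐ⁰ :=
    { toFun := fun a => if a = 0 then 0 else WithZero.exp (-δ a)
      map_zero' := if_pos rfl
      map_one' := by rw [if_neg one_ne_zero, hone, neg_zero, WithZero.exp_zero]
      map_mul' := fun a b => by
        by_cases ha : a = 0
        · simp [ha]
        by_cases hb : b = 0
        · simp [hb]
        rw [if_neg (mul_ne_zero ha hb), if_neg ha, if_neg hb, hmul a b ha hb, neg_add,
          WithZero.exp_add]
      map_add_le_max' := fun a b => by
        by_cases ha : a = 0
        · simp [ha]
        by_cases hb : b = 0
        · simp [hb]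
        by_cases hab : a + b = 0
        · simp [hab]
        rw [if_neg hab, if_neg ha, if_neg hb, le_max_iff, WithZero.exp_le_exp,
          WithZero.exp_le_exp]
        have := hadd a b ha hb hab
        rw [min_le_iff] at this
        omega }
  have hw : ∀ a, a ≠ 0 → w a = WithZero.exp (-δ a) := fun a ha => if_neg ha
  have hS : nonZeroDivisors P ≤ w.supp.primeCompl := by
    intro a ha h
    rw [SetLike.mem_coe, Valuation.mem_supp_iff, hw a (nonZeroDivisors.ne_zero ha)] at h
    exact WithZero.exp_ne_zero h
  let v := w.extendToLocalization hS F
  have hv : ∀ a, a ≠ 0 → v (algebraMap P F a) = WithZero.exp (-δ a) := fun a ha => by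
    rw [← hw a ha]
    exact w.extendToLocalization_apply_map_apply hS F a
  refine ⟨⟨v, fun x => ?_⟩, fun a ha => ?_⟩
  · by_cases hx : x = 0
    · exact ⟨0, by rw [hx, map_zero]⟩
    rw [← WithZero.exp_log hx]
    generalize WithZero.log x = k
    rcases hδt with h | h
    · refine ⟨algebraMap P F t ^ (-k), ?_⟩
      rw [map_zpow₀, hv t ht, h, ← WithZero.exp_zsmul]
      simp
    · refine ⟨algebraMap P F t ^ k, ?_⟩
      rw [map_zpow₀, hv t ht, h, ← WithZero.exp_zsmul]
      simp
  · rw [ord, hv a ha, WithZero.log_exp, neg_neg]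

theorem exists_ord_eq_multiplicity {P : Type*} (F : Type*) [CommRing P] [IsDomain P]
    [UniqueFactorizationMonoid P] [Field F] [Algebra P F] [IsFractionRing P F] {p : P}
    (hp : Prime p) :
    ∃ ν : DiscreteValuation F, ∀ a, a ≠ 0 → ν.ord (algebraMap P F a) = multiplicity p a := by
  have hfin : ∀ a, a ≠ 0 → FiniteMultiplicity p a := fun a ha =>
    FiniteMultiplicity.of_prime_left hp ha
  refine exists_of_ord (fun a => (multiplicity p a : ℤ)) ?_ ?_ ?_ hp.ne_zero (Or.inl ?_)
  · rw [Nat.cast_eq_zero, multiplicity_eq_zero]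
    exact fun h => hp.not_isUnit (isUnit_of_dvd_one h)
  · intro a b ha hb
    rw [multiplicity_mul hp (hfin _ (mul_ne_zero ha hb)), Nat.cast_add]
  · intro a b ha hb hab
    rw [← Nat.cast_min, Nat.cast_le]
    apply (hfin _ hab).le_multiplicity_of_pow_dvd
    refine dvd_add ?_ ?_
    · exact (pow_dvd_pow p (min_le_left _ _)).trans (pow_multiplicity_dvd p a)
    · exact (pow_dvd_pow p (min_le_right _ _)).trans (pow_multiplicity_dvd p b)
  · rw [Nat.cast_eq_one]
    exact multiplicity_self

/-- The valuation at infinity: a polynomial integral for it is constant. Its value group is all of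
`ℤ` because a variable has value `-1`. -/
theorem exists_ord_eq_neg_totalDegree {σ R : Type*} (F : Type*) [CommRing R] [IsDomain R]
    [Nonempty σ] [Field F] [Algebra (MvPolynomial σ R) F] [IsFractionRing (MvPolynomial σ R) F] :
    ∃ ν : DiscreteValuation F, ∀ a : MvPolynomial σ R, a ≠ 0 →
      ν.ord (algebraMap _ F a) = -(a.totalDegree : ℤ) := by
  obtain ⟨i⟩ := ‹Nonempty σ›
  refine exists_of_ord (fun a : MvPolynomial σ R => -(a.totalDegree : ℤ)) (by simp) ?_ ?_
    (t := MvPolynomial.X i) (MvPolynomial.X_ne_zero i) (Or.inr (by simp))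
  · intro a b ha hb
    rw [MvPolynomial.totalDegree_mul_of_isDomain ha hb]
    push_cast
    ring
  · intro a b _ _ _
    have := MvPolynomial.totalDegree_add a b
    rw [le_max_iff] at this
    rw [min_le_iff]
    omega

/-! ### Finitely many valuations that detect algebraic integers -/

variable {F : Type*} [Field F]

/-- The discrete valuation of an extension field attached to a prime of a Dedekind domain. -/
def ofHeightOneSpectrum {C : Type*} (K : Type*) [CommRing C] [IsDedekindDomain C] [Field K]
    [Algebra C K] [IsFractionRing C K] (w : IsDedekindDomain.HeightOneSpectrum C) :
    DiscreteValuation K :=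
  ⟨w.valuation K, w.valuation_surjective K⟩

/-- The integral closure of the valuation ring in `K` is a Dedekind domain whose nonzero primes all
lie over one maximal ideal, hence are finite in number; it is the intersection of its localisations.
-/
theorem exists_finite_extensions (ν : DiscreteValuation F) (K : Type*) [Field K] [Algebra F K]
    [FiniteDimensional F K] [CharZero F] :
    ∃ T : Set (DiscreteValuation K), T.Finite ∧
      ∀ a : K, (∀ μ ∈ T, a ∈ μ.integers) → IsIntegral ν.integers a := by
  let C := integralClosure ν.integers K
  have : IsDedekindDomain C := integralClosure.isDedekindDomain ν.integers F K
  have : IsFractionRing C K := integralClosure.isFractionRing_of_finite_extension F K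
  have : Finite (IsDedekindDomain.HeightOneSpectrum C) := by
    have h := IsDedekindDomain.primesOver_finite (B := C)
      (IsLocalRing.maximalIdeal ν.integers)
    have := h.to_subtype
    refine Finite.of_injective
      (fun w => (⟨w.asIdeal, w.isPrime, ⟨?_⟩⟩ :
        (IsLocalRing.maximalIdeal ν.integers).primesOver C)) ?_
    · have h1 := (w.under ν.integers).isMaximal
      exact (IsLocalRing.eq_maximalIdeal h1).symm
    · intro w w' h
      exact IsDedekindDomain.HeightOneSpectrum.ext (congrArg Subtype.val h)
  refine ⟨Set.range (ofHeightOneSpectrum (C := C) K), Set.finite_range _, fun a ha => ?_⟩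
  obtain ⟨c, rfl⟩ := IsDedekindDomain.HeightOneSpectrum.mem_integers_of_valuation_le_one K a
    (R := C) fun w => ha _ ⟨w, rfl⟩
  exact c.2

theorem minpoly_coeff_mem_integers {ν : DiscreteValuation F} {K : Type*} [Field K] [Algebra F K]
    {a : K} (h : IsIntegral ν.integers a) (j : ℕ) : (minpoly F a).coeff j ∈ ν.integers := by
  rw [minpoly.isIntegrallyClosed_eq_field_fractions' F h, Polynomial.coeff_map]
  exact ((minpoly ν.integers a).coeff j).2

/-- A prime dividing the reduced denominator would give `y` negative order. Among primes dividing
`f` only the listed factors are tested, so that finitely many valuations suffice despite associates.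
-/
theorem mem_range_of_forall_prime {P : Type*} [CommRing P] [IsDomain P]
    [UniqueFactorizationMonoid P] [Algebra P F] [IsFractionRing P F] {f : P} (hf : f ≠ 0) {y : F}
    (h : ∀ p : P, Prime p → (p ∈ UniqueFactorizationMonoid.factors f ∨ ¬ p ∣ f) →
      ∃ ν : DiscreteValuation F,
        (∀ a, a ≠ 0 → ν.ord (algebraMap P F a) = multiplicity p a) ∧ y ∈ ν.integers) :
    y ∈ (algebraMap P F).range := by
  by_cases hy : y = 0
  · exact ⟨0, by rw [hy, map_zero]⟩
  by_cases hu : IsUnit (IsFractionRing.den P y : P)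
  · exact IsFractionRing.isInteger_of_isUnit_den hu
  exfalso
  have hden : (IsFractionRing.den P y : P) ≠ 0 :=
    nonZeroDivisors.ne_zero (IsFractionRing.den P y).2
  obtain ⟨q, hq, hqden, hqf⟩ : ∃ q : P, Prime q ∧ q ∣ IsFractionRing.den P y ∧
      (q ∈ UniqueFactorizationMonoid.factors f ∨ ¬ q ∣ f) := by
    obtain ⟨p, hp, hpd⟩ := WfDvdMonoid.exists_irreducible_factor hu hden
    by_cases hpf : p ∣ f
    · obtain ⟨q, hq, hpq⟩ := UniqueFactorizationMonoid.exists_mem_factors_of_dvd hf hp hpf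
      exact ⟨q, UniqueFactorizationMonoid.prime_of_factor q hq, hpq.symm.dvd.trans hpd, Or.inl hq⟩
    · exact ⟨p, hp.prime, hpd, Or.inr hpf⟩
  have hqnum : ¬ q ∣ IsFractionRing.num P y := fun hcon =>
    hq.not_isUnit (IsFractionRing.num_den_reduced P y hcon hqden)
  have hnum : IsFractionRing.num P y ≠ 0 := fun h0 => hqnum (h0 ▸ dvd_zero q)
  obtain ⟨ν, hν, hyν⟩ := h q hq hqf
  have h1 : y * algebraMap P F (IsFractionRing.den P y) =
      algebraMap P F (IsFractionRing.num P y) :=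
    IsFractionRing.num_mul_den_eq_num_iff_eq.mpr rfl
  have h2 := congrArg ν.ord h1
  have hden' : algebraMap P F (IsFractionRing.den P y) ≠ 0 := by
    rwa [ne_eq, FaithfulSMul.algebraMap_eq_zero_iff]
  rw [ord_mul hy hden', hν _ hden, hν _ hnum, multiplicity_eq_zero.mpr hqnum] at h2
  have h3 := (mem_integers_iff hy).mp hyν
  have h4 : multiplicity q (IsFractionRing.den P y : P) ≠ 0 := fun h0 =>
    multiplicity_eq_zero.mp h0 hqden
  omega

/-- As `p` does not divide `f`, the element `f` is a unit of the valuation ring and can be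
cancelled. -/
theorem isIntegral_integers_of_pow_mul {P : Type*} [CommRing P] [IsDomain P] [Algebra P F]
    [IsFractionRing P F] {K : Type*} [Field K] [Algebra F K] [Algebra P K] [IsScalarTower P F K]
    {ν : DiscreteValuation F} {p f : P} (hp : ¬ p ∣ f) (hf : f ≠ 0)
    (hν : ∀ a, a ≠ 0 → ν.ord (algebraMap P F a) = multiplicity p a) {a : K} {k : ℕ}
    (h : IsIntegral P (f ^ k • a)) : IsIntegral ν.integers a := by
  have hmem : ∀ x, algebraMap P F x ∈ ν.integers := by
    intro x
    by_cases hx : x = 0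
    · rw [hx, map_zero]
      exact zero_mem _
    · rw [mem_integers_iff (by rwa [ne_eq, FaithfulSMul.algebraMap_eq_zero_iff]), hν x hx]
      omega
  have hf' : algebraMap P F f ≠ 0 := by rwa [ne_eq, FaithfulSMul.algebraMap_eq_zero_iff]
  have hinv : (algebraMap P F f)⁻¹ ∈ ν.integers := by
    rw [mem_integers_iff (inv_ne_zero hf'), ord_inv, hν f hf, multiplicity_eq_zero.mpr hp]
    simp
  have h1 : IsIntegral ν.integers (f ^ k • a) :=
    h.map_of_comp_eq ((algebraMap P F).codRestrict ν.integers hmem) (RingHom.id K) (by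
      ext x
      exact (IsScalarTower.algebraMap_apply P F K x).symm)
  have h2 : a = (⟨_, hinv⟩ ^ k : ν.integers) • (f ^ k • a) := by
    rw [Algebra.smul_def, Algebra.smul_def (f ^ k) a, IsScalarTower.algebraMap_apply P F K,
      IsScalarTower.algebraMap_apply ν.integers F K, ← mul_assoc, ← map_mul]
    have : algebraMap ν.integers F (⟨_, hinv⟩ ^ k) * algebraMap P F (f ^ k) = 1 := by
      rw [map_pow, map_pow, ← mul_pow]
      exact (congrArg (· ^ k) (inv_mul_cancel₀ hf')).trans (one_pow k)
    rw [this, map_one, one_mul]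
  rw [h2]
  exact h1.smul _

theorem exists_finite_isIntegral (σ : Type*) (F K : Type*) [Field F] [Field K]
    [Algebra (MvPolynomial σ ℤ) F] [IsFractionRing (MvPolynomial σ ℤ) F] [Algebra F K]
    [FiniteDimensional F K] [CharZero F] [Algebra (MvPolynomial σ ℤ) K]
    [IsScalarTower (MvPolynomial σ ℤ) F K] {f : MvPolynomial σ ℤ} (hf : f ≠ 0) :
    ∃ T : Set (DiscreteValuation K), T.Finite ∧
      ∀ a : K, (∃ k, IsIntegral (MvPolynomial σ ℤ) (f ^ k • a)) →
        (∀ μ ∈ T, a ∈ μ.integers) → IsIntegral ℤ a := by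
  classical
  have hprime : ∀ p : MvPolynomial σ ℤ, ∃ T : Set (DiscreteValuation K), T.Finite ∧
      (p ∈ UniqueFactorizationMonoid.factors f → ∃ ν : DiscreteValuation F,
        (∀ a, a ≠ 0 → ν.ord (algebraMap _ F a) = multiplicity p a) ∧
          ∀ a : K, (∀ μ ∈ T, a ∈ μ.integers) → IsIntegral ν.integers a) := by
    intro p
    by_cases hp : p ∈ UniqueFactorizationMonoid.factors f
    · obtain ⟨ν, hν⟩ :=
        exists_ord_eq_multiplicity F (UniqueFactorizationMonoid.prime_of_factor p hp)
      obtain ⟨T, hT, hTa⟩ := ν.exists_finite_extensions K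
      exact ⟨T, hT, fun _ => ⟨ν, hν, hTa⟩⟩
    · exact ⟨∅, Set.finite_empty, fun h => absurd h hp⟩
  choose T hTfin hT using hprime
  obtain ⟨T', hT'fin, hT'⟩ : ∃ T' : Set (DiscreteValuation K), T'.Finite ∧
      ∀ a : K, (∀ μ ∈ T', a ∈ μ.integers) → ∀ j (x : MvPolynomial σ ℤ),
        (minpoly F a).coeff j = algebraMap _ F x → x ∈ Set.range MvPolynomial.C := by
    -- Without variables every polynomial is constant and no valuation at infinity is needed.
    rcases isEmpty_or_nonempty σ with hσ | hσ
    · exact ⟨∅, Set.finite_empty, fun a _ j x _ => ⟨_, (MvPolynomial.eq_C_of_isEmpty x).symm⟩⟩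
    · obtain ⟨ν', hν'⟩ := exists_ord_eq_neg_totalDegree (σ := σ) (R := ℤ) F
      obtain ⟨T', hfin, hT'⟩ := ν'.exists_finite_extensions K
      refine ⟨T', hfin, fun a ha j x hx => ?_⟩
      have h1 := minpoly_coeff_mem_integers (hT' a ha) j
      by_cases hx0 : x = 0
      · exact ⟨0, by rw [hx0, map_zero]⟩
      rw [hx, mem_integers_iff (by rwa [ne_eq, FaithfulSMul.algebraMap_eq_zero_iff]),
        hν' x hx0] at h1
      exact ⟨_, (MvPolynomial.totalDegree_eq_zero_iff_eq_C.mp (by omega)).symm⟩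
  refine ⟨T' ∪ ⋃ p ∈ (UniqueFactorizationMonoid.factors f).toFinset, T p,
    hT'fin.union (Set.Finite.biUnion (Finset.finite_toSet _) fun p _ => hTfin p), ?_⟩
  rintro a ⟨k, hk⟩ ha
  have hcoeff : ∀ j, (minpoly F a).coeff j ∈ (algebraMap (MvPolynomial σ ℤ) F).range := by
    intro j
    apply mem_range_of_forall_prime hf
    rintro p hp (hpf | hpf)
    · obtain ⟨ν, hν, hTν⟩ := hT p hpf
      refine ⟨ν, hν, minpoly_coeff_mem_integers (hTν a fun μ hμ => ha μ (Or.inr ?_)) j⟩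
      exact Set.mem_biUnion (Multiset.mem_toFinset.mpr hpf) hμ
    · obtain ⟨ν₀, hν₀⟩ := exists_ord_eq_multiplicity F hp
      exact ⟨ν₀, hν₀, minpoly_coeff_mem_integers
        (isIntegral_integers_of_pow_mul hpf hf hν₀ hk) j⟩
  have hlift : minpoly F a ∈ Polynomial.lifts (algebraMap ℤ F) := by
    rw [Polynomial.lifts_iff_coeff_lifts]
    intro j
    obtain ⟨x, hx⟩ := hcoeff j
    obtain ⟨c, rfl⟩ := hT' a (fun μ hμ => ha μ (Or.inl hμ)) j x hx.symm
    exact ⟨c, by rw [← hx]; simp⟩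
  have hint : IsIntegral F a := Algebra.IsIntegral.isIntegral a
  obtain ⟨q, hq, -, hqm⟩ :=
    Polynomial.lifts_and_natDegree_eq_and_monic hlift (minpoly.monic hint)
  refine ⟨q, hqm, ?_⟩
  have h0 := minpoly.aeval F a
  rw [← hq, Polynomial.aeval_def, Polynomial.eval₂_map,
    RingHom.ext_int ((algebraMap F K).comp (algebraMap ℤ F)) (algebraMap ℤ K)] at h0
  exact h0

/-- A finitely generated domain of characteristic zero has finitely many discrete valuations such
that all its elements which are integral for each of them are algebraic integers. -/
theorem exists_finite_isIntegral_of_finiteType (A : Type*) [CommRing A] [IsDomain A] [CharZero A]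
    (hA : Algebra.FiniteType ℤ A) (K : Type*) [Field K] [Algebra A K] [IsFractionRing A K] :
    ∃ T : Set (DiscreteValuation K), T.Finite ∧
      ∀ a : A, (∀ μ ∈ T, algebraMap A K a ∈ μ.integers) → IsIntegral ℤ a := by
  classical
  obtain ⟨s, hs⟩ := hA.out
  have halg : Algebra.IsAlgebraic (Algebra.adjoin ℤ (s : Set A)) A := by
    rw [hs]
    exact ⟨fun a => isAlgebraic_algebraMap (⟨a, trivial⟩ : (⊤ : Subalgebra ℤ A))⟩
  obtain ⟨t, -, ht⟩ := exists_isTranscendenceBasis_subset (R := ℤ) (s : Set A)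
  let P := MvPolynomial t ℤ
  let φ : P →ₐ[ℤ] A := MvPolynomial.aeval ((↑) : t → A)
  have hφ : Function.Injective φ := ht.1
  let _ : Algebra P A := φ.toRingHom.toAlgebra
  have : FaithfulSMul P A := (faithfulSMul_iff_algebraMap_injective P A).mpr hφ
  have hPA : Algebra.IsAlgebraic P A := by
    have h1 := ht.isAlgebraic
    refine ⟨fun a => ?_⟩
    have h2 := h1.isAlgebraic a
    exact h2.of_ringHom_of_comp_eq ht.1.aevalEquiv.toRingHom (RingHom.id A)
      ht.1.aevalEquiv.surjective Function.injective_id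
      (RingHom.ext ht.1.algebraMap_aevalEquiv)
  let _ : Algebra P K := ((algebraMap A K).comp (algebraMap P A)).toAlgebra
  have : IsScalarTower P A K := IsScalarTower.of_algebraMap_eq fun _ => rfl
  have : FaithfulSMul P K := FaithfulSMul.trans P A K
  let F := FractionRing P
  let _ : Algebra F K := FractionRing.liftAlgebra P K
  have : IsScalarTower P F K := inferInstance
  have hAK : Algebra.IsAlgebraic A K := IsFractionRing.comap_isAlgebraic_iff (K := K) |>.mpr inferInstance
  have hPK : Algebra.IsAlgebraic P K := Algebra.IsAlgebraic.trans P A K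
  have hFK : Algebra.IsAlgebraic F K := (IsFractionRing.comap_isAlgebraic_iff (A := P)).mp hPK
  have : FiniteDimensional F K := by
    have h1 : FiniteDimensional F (IntermediateField.adjoin F (algebraMap A K '' s)) := by
      have := (s.finite_toSet.image (algebraMap A K)).to_subtype
      exact IntermediateField.finiteDimensional_adjoin fun x _ => hFK.isIntegral.isIntegral x
    have h2 : IntermediateField.adjoin F (algebraMap A K '' s) = ⊤ := by
      have h3 : ∀ a : A, algebraMap A K a ∈ IntermediateField.adjoin F (algebraMap A K '' s) := by
        intro a
        have ha : a ∈ Algebra.adjoin ℤ (s : Set A) := hs ▸ trivial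
        induction ha using Algebra.adjoin_induction with
        | mem x hx => exact IntermediateField.subset_adjoin _ _ ⟨x, hx, rfl⟩
        | algebraMap r => simp
        | add x y _ _ hx hy => rw [map_add]; exact add_mem hx hy
        | mul x y _ _ hx hy => rw [map_mul]; exact mul_mem hx hy
      rw [eq_top_iff]
      intro x _
      obtain ⟨a, b, -, rfl⟩ := IsFractionRing.div_surjective A x
      exact div_mem (h3 a) (h3 b)
    rw [h2] at h1
    exact IntermediateField.topEquiv.toLinearEquiv.finiteDimensional
  have : CharZero F := charZero_of_injective_algebraMap (FaithfulSMul.algebraMap_injective P F)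
  -- A common denominator for the finitely many generators; powers of it then serve for sums and
  -- products of them.
  obtain ⟨f, hf, hfs⟩ : ∃ f : P, f ≠ 0 ∧ ∀ a ∈ s, IsIntegral P (f • a) := by
    choose c hc hca using fun a : A => (hPA.isAlgebraic a).exists_integral_multiple
    refine ⟨∏ a ∈ s, c a, Finset.prod_ne_zero_iff.mpr fun a _ => hc a, fun a ha => ?_⟩
    rw [← Finset.prod_erase_mul s c ha, mul_smul]
    exact (hca a).smul _
  have hfA : ∀ a : A, ∃ k, IsIntegral P (f ^ k • a) := by
    intro a
    have ha : a ∈ Algebra.adjoin ℤ (s : Set A) := hs ▸ trivial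
    induction ha using Algebra.adjoin_induction with
    | mem x hx => exact ⟨1, by rw [pow_one]; exact hfs x hx⟩
    | algebraMap r =>
      refine ⟨0, ?_⟩
      rw [pow_zero, one_smul, eq_intCast, ← map_intCast (algebraMap P A)]
      exact isIntegral_algebraMap
    | add x y _ _ hx hy =>
      obtain ⟨k, hk⟩ := hx
      obtain ⟨l, hl⟩ := hy
      refine ⟨k + l, ?_⟩
      rw [smul_add]
      nth_rewrite 1 [add_comm k l]
      rw [pow_add, pow_add, mul_smul, mul_smul]
      exact (hk.smul _).add (hl.smul _)
    | mul x y _ _ hx hy =>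
      obtain ⟨k, hk⟩ := hx
      obtain ⟨l, hl⟩ := hy
      refine ⟨k + l, ?_⟩
      rw [pow_add, ← smul_mul_smul_comm]
      exact hk.mul hl
  obtain ⟨T, hT, hTa⟩ := exists_finite_isIntegral t F K hf
  refine ⟨T, hT, fun a ha => ?_⟩
  obtain ⟨k, hk⟩ := hfA a
  have := hTa (algebraMap A K a) ⟨k, ?_⟩ ha
  · exact (isIntegral_algebraMap_iff (IsFractionRing.injective A K)).mp this
  · have := hk.map (IsScalarTower.toAlgHom P A K)
    rwa [map_smul] at this

end DiscreteValuation

/-! ### Isotropy groups and the main theorem -/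

theorem isIntegral_charpoly_coeff_of_stabilizer {A : Subring ℂ} {K : Type*} [Field K]
    [Algebra A K] {n : ℕ} (hn : 1 ≤ n) {T : Set (DiscreteValuation K)}
    (hT : ∀ a : A, (∀ μ ∈ T, algebraMap A K a ∈ μ.integers) → IsIntegral ℤ a)
    (γ : Matrix.SpecialLinearGroup (Fin n) A)
    (hγ : ∀ μ ∈ T, ∃ x : μ.Realization n,
      Matrix.SpecialLinearGroup.map (algebraMap A K) γ • x = x) (k : ℕ) :
    IsIntegral ℤ (((Matrix.SpecialLinearGroup.map A.subtype γ :
      Matrix.SpecialLinearGroup (Fin n) ℂ) : Matrix (Fin n) (Fin n) ℂ).charpoly.coeff k) := by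
  have h1 : IsIntegral ℤ ((γ : Matrix (Fin n) (Fin n) A).charpoly.coeff k) := by
    apply hT
    intro μ hμ
    obtain ⟨x, hx⟩ := hγ μ hμ
    have := DiscreteValuation.charpoly_coeff_mem_integers_of_smul_eq hn hx k
    rwa [Matrix.SpecialLinearGroup.map_apply_coe, RingHom.mapMatrix_apply, Matrix.charpoly_map,
      Polynomial.coeff_map] at this
  rw [Matrix.SpecialLinearGroup.map_apply_coe, RingHom.mapMatrix_apply, Matrix.charpoly_map,
    Polynomial.coeff_map]
  exact h1.map_of_comp_eq (RingHom.id ℤ) A.subtype (RingHom.ext_int _ _)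

end

theorem mainTheorem5 (A : Subring ℂ) (hA : Algebra.FiniteType ℤ A)
    (K : Type*) [Field K] [Algebra A K] [IsFractionRing A K]
    (n : ℕ) (hn : 1 ≤ n)
    (Γ : Subgroup (Matrix.SpecialLinearGroup (Fin n) A)) (hΓ : Γ.FG) :
    ∃ (m : ℕ) (ν : Fin m → DiscreteValuation K),
      (∀ i, ((ν i).building n).HasDimension (n - 1) ∧
        IsGenuineMetric ((ν i).Realization n) ∧
        HasFiniteAsdim ((ν i).Realization n) ∧
        ∀ γ ∈ Γ, Isometry fun x : (ν i).Realization n =>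
          Matrix.SpecialLinearGroup.map (algebraMap A K) γ • x) ∧
      ∀ x : (∀ i, (ν i).Realization n), HasIntegralCharacteristic (isotropyGroup Γ ν x) := by
  obtain ⟨T, hTfin, hT⟩ :=
    DiscreteValuation.exists_finite_isIntegral_of_finiteType A hA K
  obtain ⟨m, ν, -, hν⟩ := hTfin.fin_param
  refine ⟨m, ν, fun i => ⟨DiscreteValuation.building_hasDimension _ hn,
    DiscreteValuation.isGenuineMetric_realization _ hn,
    ⟨_, DiscreteValuation.asdimLE_realization _ hn⟩,
    fun γ _ => DiscreteValuation.isometry_smul _⟩, fun x => ?_⟩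
  rintro _ ⟨γ, hγ, rfl⟩ k
  refine isIntegral_charpoly_coeff_of_stabilizer hn hT γ.1 (fun μ hμ => ?_) k
  obtain ⟨i, rfl⟩ : μ ∈ Set.range ν := hν ▸ hμ
  -- A point of the product fixed by the diagonal action has each component fixed.
  exact ⟨x i, congrFun hγ i⟩
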